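/- Let $A$ be a finite set and $R\subseteq\widetilde A^*\times\widetilde A^*$, where $\widetilde X=X\cup X^{-1}$. For a presentation ${\rm Inv}\langle X\mid S\rangle$ let $\rho_X$ be the Vagner congruence on $\widetilde X^*$ and $(\rho_X\cup S)^\sharp$ the congruence defining the presented inverse monoid; let $M=\widetilde A^*/\tau$, $\tau=(\rho_A\cup R)^\sharp$. Write $A=\{a_1,\dots,a_n\}$, $A_i=A\setminus\{a_i\}$, let $\theta_i:\widetilde A^*\to\widetilde{A_i}^*$ be the homomorphism erasing $a_i^{\pm1}$, $R\overline\theta_i=\{(r\theta_i,s\theta_i):(r,s)\in R\}$, $\tau_i=(\rho_{A_i}\cup R\overline\theta_i)^\sharp$, $M_i=\widetilde{A_i}^*/\tau_i$, and let $\epsilon^{\mathcal P}:M\to\prod_{i=1}^nM_i$, $w\tau\mapsto((w\theta_1)\tau_1,\dots,(w\theta_n)\tau_n)$, be the eraser morphism. For $u_i\in\widetilde{A_i}^*$ let $\mathcal A(u_i)$ be the Schützenberger automaton of $u_i$ with respect to ${\rm Inv}\langle A_i\mid R\overline\theta_i\rangle$: the subgraph of the Cayley graph of $M_i$ (with edges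 labelled in $\widetilde{A_i}$) induced on the $\mathcal R$-class of $u_i\tau_i$, with initial state $(u_iu_i^{-1})\tau_i$ and terminal state $u_i\tau_i$. Let $\widehat{\mathcal A}(u_i)$ be $\mathcal A(u_i)$ with loops labelled $a_i$ and $a_i^{-1}$ added at every state, and let $\mathcal P(u_1,\dots,u_n)$ be the trim part (the states lying on successful paths) of the product automaton $\widehat{\mathcal A}(u_1)\times\dots\times\widehat{\mathcal A}(u_n)$. For an involutive $\widetilde A$-automaton $\mathcal B$, let $\chi_{a_i}(\mathcal B)$ be obtained by identifying the endpoints of every edge labelled $a_i$, erasing the edges labelled $a_i^{\pm1}$, and folding (identifying states reached from a common state by equally labelled edges until the automaton is deterministic). For a set $S$ of relations on $\widetilde X^*$ and an involutive $\widetilde X$-automaton $\mathcal B$, let ${\rm Cl}_S(\mathcal B)$ be the colimit of the automata obtained from $\mathcal B$ by sequences of foldings and of elementary expansions (if $v$ labels a path $q_1\to q_2$ and $(u,v)\in S$ or $(v,u)\in S$, adjoin a path $q_1\to q_2$ labelled $u$ together with its inverse path; if $u$ is empty, identify $q_1$ and $q_2$). **Proposition.** For all $u_i\in\widetilde{A_i}^*$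 $(1\le i\le n)$, the tuple $(u_1\tau_1,\dots,u_n\tau_n)$ lies in ${\rm Im}\,\epsilon^{\mathcal P}$ if and only if $${\rm Cl}_{R\overline\theta_i}\bigl(\chi_{a_i}(\mathcal P(u_1,\dots,u_n))\bigr)\cong\mathcal A(u_i)\quad\text{for all } i=1,\dots,n,$$ where $\cong$ is isomorphism of automata (preserving edges, labels, initial and terminal states). -/

import Mathlib

universe u

/-! ### Words over `X ∪ X⁻¹` and inverse monoid presentations -/

/-- Words over `X ∪ X⁻¹`. The letter `(x, true)` is `x` and `(x, false)` is the formal inverse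
of `x` (the convention of `FreeGroup`). -/
abbrev InvWord (X : Type u) : Type u := FreeMonoid (X × Bool)

/-- The involution on the alphabet `X ∪ X⁻¹`. -/
def letterInv {X : Type u} (x : X × Bool) : X × Bool := (x.1, !x.2)

/-- The involution `w ↦ w⁻¹` on words: reverse the word and invert each letter. -/
def wordInv {X : Type u} (w : InvWord X) : InvWord X :=
  FreeMonoid.ofList (FreeMonoid.toList w |>.map letterInv).reverse

/-- The generating pairs of the Vagner congruence. -/
inductive VagnerRel {X : Type u} : InvWord X → InvWord X → Prop
  | regular (w : InvWord X) : VagnerRel (w * wordInv w * w) w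
  | commute (v w : InvWord X) :
      VagnerRel (v * wordInv v * (w * wordInv w)) (w * wordInv w * (v * wordInv v))

/-- The Vagner congruence `ρ_X`; its quotient is the free inverse monoid on `X`. -/
def vagnerCon (X : Type u) : Con (InvWord X) := conGen VagnerRel

/-- The congruence `(ρ_X ∪ R)^♯`. -/
def presCon {X : Type u} (R : Set (InvWord X × InvWord X)) : Con (InvWord X) :=
  conGen fun v w => vagnerCon X v w ∨ (v, w) ∈ R

/-- The inverse monoid defined by the presentation `Inv⟨X | R⟩`. -/
abbrev InvPres {X : Type u} (R : Set (InvWord X × InvWord X)) : Type u := (presCon R).Quotient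

/-- Green's relation `𝓡` on a monoid. -/
def GreenR {M : Type u} [Monoid M] (m n : M) : Prop := (∃ x, m = n * x) ∧ ∃ y, n = m * y

theorem wordInv_mul {X : Type u} (v w : InvWord X) :
    wordInv (v * w) = wordInv w * wordInv v := by
  apply FreeMonoid.toList.injective
  simp [wordInv]

theorem presCon_of_vagnerRel {X : Type u} (R : Set (InvWord X × InvWord X)) {v w : InvWord X}
    (h : VagnerRel v w) : presCon R v w :=
  ConGen.Rel.of _ _ (Or.inl (ConGen.Rel.of _ _ h))

theorem greenR_mul_wordInv {X : Type u} (R : Set (InvWord X × InvWord X)) (w : InvWord X) :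
    GreenR ((w * wordInv w : InvWord X) : InvPres R) (w : InvPres R) :=
  ⟨⟨((wordInv w : InvWord X) : InvPres R), rfl⟩, (w : InvPres R),
    ((presCon R).eq.2 (presCon_of_vagnerRel R (.regular w))).symm⟩

/-! ### The eraser morphism -/

/-- The homomorphism `θ_i` deleting all occurrences of `i` and `i⁻¹` from a word. -/
def eraseWord {A : Type u} [DecidableEq A] (i : A) : InvWord A →* InvWord {a : A // a ≠ i} :=
  FreeMonoid.lift fun x => if h : x.1 ≠ i then FreeMonoid.of (⟨x.1, h⟩, x.2) else 1

/-- The relations obtained from `R` by applying `θ_i` to both sides. -/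
def eraseRel {A : Type u} [DecidableEq A] (i : A) (R : Set (InvWord A × InvWord A)) :
    Set (InvWord {a : A // a ≠ i} × InvWord {a : A // a ≠ i}) :=
  (fun r => (eraseWord i r.1, eraseWord i r.2)) '' R

theorem eraseWord_wordInv {A : Type u} [DecidableEq A] (i : A) (w : InvWord A) :
    eraseWord i (wordInv w) = wordInv (eraseWord i w) := by
  induction w using FreeMonoid.recOn with
  | one => rfl
  | of_mul x w ih =>
    rw [wordInv_mul, map_mul, map_mul, wordInv_mul, ih]
    congr 1
    have h : wordInv (FreeMonoid.of x) = FreeMonoid.of (letterInv x) := rfl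
    rw [h, eraseWord, FreeMonoid.lift_eval_of, FreeMonoid.lift_eval_of]
    by_cases hx : x.1 = i
    · simp [letterInv, hx]
      rfl
    · simp [letterInv, hx]
      rfl

theorem presCon_le_ker_eraseWord {A : Type u} [DecidableEq A] (i : A)
    (R : Set (InvWord A × InvWord A)) :
    presCon R ≤ Con.ker ((presCon (eraseRel i R)).mk'.comp (eraseWord i)) := by
  refine Con.conGen_le.2 ?_
  rintro v w (h | h)
  · have key : vagnerCon A ≤ Con.ker ((presCon (eraseRel i R)).mk'.comp (eraseWord i)) := by
      refine Con.conGen_le.2 ?_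
      intro v w h
      refine (presCon (eraseRel i R)).eq.2 (presCon_of_vagnerRel _ ?_)
      cases h with
      | regular w =>
        simp only [map_mul, eraseWord_wordInv]
        exact .regular _
      | commute v w =>
        simp only [map_mul, eraseWord_wordInv]
        exact .commute _ _
    exact key h
  · exact (presCon (eraseRel i R)).eq.2 (ConGen.Rel.of _ _ (Or.inr ⟨(v, w), h, rfl⟩))

/-- The `i`-th component of the eraser morphism, sending the class of `w` to the class
of `w θ_i`. -/
def eraserComponent {A : Type u} [DecidableEq A] (R : Set (InvWord A × InvWord A)) (i : A) :
    InvPres R →* InvPres (eraseRel i R) :=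
  (presCon R).lift ((presCon (eraseRel i R)).mk'.comp (eraseWord i))
    (presCon_le_ker_eraseWord i R)

/-- The eraser morphism. The factors are indexed by the letters themselves. -/
def eraserMorphism {A : Type u} [DecidableEq A] (R : Set (InvWord A × InvWord A)) :
    InvPres R →* ∀ i : A, InvPres (eraseRel i R) :=
  MonoidHom.pi fun i => eraserComponent R i

/-! ### Automata -/

/-- Automata `(Q, I, T, E)` over the alphabet `S`; no finiteness or determinism is assumed. -/
structure Automaton (S : Type u) where
  State : Type u
  init : Set State
  final : Set State
  edge : State → S → State → Prop

namespace Automaton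

variable {S : Type u}

/-- `B.Reads w p q`: there is a path from `p` to `q` in `B` with label `w`. -/
def Reads (B : Automaton S) : List S → B.State → B.State → Prop
  | [], p, q => p = q
  | a :: w, p, q => ∃ r, B.edge p a r ∧ B.Reads w r q

/-- Isomorphism of automata. -/
def Isomorphic (B C : Automaton S) : Prop :=
  ∃ f : B.State ≃ C.State, f '' B.init = C.init ∧ f '' B.final = C.final ∧
    ∀ p a q, B.edge p a q ↔ C.edge (f p) a (f q)

/-- The trim part of an automaton: keep only the states that occur in a successful path. -/
def trim (B : Automaton S) : Automaton S where
  State := {q : B.State // ∃ p ∈ B.init, ∃ t ∈ B.final, ∃ v w, B.Reads v p q ∧ B.Reads w q t}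
  init := {q | q.1 ∈ B.init}
  final := {q | q.1 ∈ B.final}
  edge p a q := B.edge p.1 a q.1

/-- The automaton obtained by identifying states along (the equivalence relation generated by)
the relation `r`. -/
def identify (B : Automaton S) (r : B.State → B.State → Prop) : Automaton S where
  State := Quot r
  init := Quot.mk r '' B.init
  final := Quot.mk r '' B.final
  edge x a y := ∃ p q, B.edge p a q ∧ Quot.mk r p = x ∧ Quot.mk r q = y

/-- The identifications made by iterated folding: the least equivalence relation such that
equally labelled edges leaving equivalent states end in equivalent states. -/
inductive FoldRel (B : Automaton S) : B.State → B.State → Prop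
  | refl (p) : FoldRel B p p
  | symm {p q} : FoldRel B p q → FoldRel B q p
  | trans {p q r} : FoldRel B p q → FoldRel B q r → FoldRel B p r
  | fold {p p' q q'} {a : S} : FoldRel B p p' → B.edge p a q → B.edge p' a q' → FoldRel B q q'

/-- The folding `Fold(B)`, also for infinite `B`. -/
def fold (B : Automaton S) : Automaton S := B.identify B.FoldRel

/-- The product of a family of automata over the same alphabet. -/
def prod {ι : Type u} (B : ι → Automaton S) : Automaton S where
  State := ∀ i, (B i).State
  init := {p | ∀ i, p i ∈ (B i).init}
  final := {p | ∀ i, p i ∈ (B i).final}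
  edge p a q := ∀ i, (B i).edge (p i) a (q i)

/-- Enlarge the alphabet by `i` and `i⁻¹`, adding at every state a loop for each of the two. -/
def addLoops {A : Type u} (i : A) (B : Automaton ({a : A // a ≠ i} × Bool)) :
    Automaton (A × Bool) where
  State := B.State
  init := B.init
  final := B.final
  edge p x q := (x.1 = i ∧ p = q) ∨ ∃ h : x.1 ≠ i, B.edge p (⟨x.1, h⟩, x.2) q

/-- Erase all the edges labelled by `i` and `i⁻¹`. -/
def eraseEdges {A : Type u} (i : A) (B : Automaton (A × Bool)) :
    Automaton ({a : A // a ≠ i} × Bool) where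
  State := B.State
  init := B.init
  final := B.final
  edge p x q := B.edge p (x.1.1, x.2) q

/-- The `i`-contracted automaton: identify the endpoints of each edge labelled `i`, erase the
edges labelled `i` or `i⁻¹` (which have become loops), and fold. -/
def contracted {A : Type u} (i : A) (B : Automaton (A × Bool)) :
    Automaton ({a : A // a ≠ i} × Bool) :=
  ((B.eraseEdges i).identify fun p q => B.edge p (i, true) q).fold

end Automaton

/-- The Schützenberger automaton of the word `w` with respect to `Inv⟨X | R⟩`: the subgraph of
the Cayley graph induced on the `𝓡`-class of `w`, with initial state `w w⁻¹` and terminal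
state `w`. -/
def schutzenberger {X : Type u} (R : Set (InvWord X × InvWord X)) (w : InvWord X) :
    Automaton (X × Bool) where
  State := {m : InvPres R // GreenR m (w : InvPres R)}
  init := {⟨((w * wordInv w : InvWord X) : InvPres R), greenR_mul_wordInv R w⟩}
  final := {⟨(w : InvPres R), ⟨1, (mul_one _).symm⟩, 1, (mul_one _).symm⟩}
  edge p x q := q.1 = p.1 * ((FreeMonoid.of x : InvWord X) : InvPres R)

/-! ### The closure of an automaton with respect to a set of relations -/

namespace Automaton

variable {X : Type u}

/-- An instance of an elementary expansion of `B`: a relation, in either direction, one of whose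
sides labels a path from `src` to `tgt`; the other side, `added`, is to be adjoined. -/
structure ExpansionSite (R : Set (InvWord X × InvWord X)) (B : Automaton (X × Bool)) where
  added : InvWord X
  present : InvWord X
  src : B.State
  tgt : B.State
  rel : (added, present) ∈ R ∨ (present, added) ∈ R
  path : B.Reads (FreeMonoid.toList present) src tgt

variable {R : Set (InvWord X × InvWord X)} {B : Automaton (X × Bool)}

/-- The word to be adjoined, as a list of letters. -/
def ExpansionSite.letters (s : ExpansionSite R B) : List (X × Bool) :=
  FreeMonoid.toList s.added

/-- The edges of the disjoint union of `B` and of the linear automata of all the words to be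
adjoined. -/
inductive UnionEdge (R : Set (InvWord X × InvWord X)) (B : Automaton (X × Bool)) :
    (B.State ⊕ Σ s : ExpansionSite R B, Fin (s.letters.length + 1)) → X × Bool →
    (B.State ⊕ Σ s : ExpansionSite R B, Fin (s.letters.length + 1)) → Prop
  | old {p x q} : B.edge p x q → UnionEdge R B (.inl p) x (.inl q)
  | forward (s : ExpansionSite R B) (k : Fin s.letters.length) :
      UnionEdge R B (.inr ⟨s, k.castSucc⟩) (s.letters.get k) (.inr ⟨s, k.succ⟩)
  | backward (s : ExpansionSite R B) (k : Fin s.letters.length) :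
      UnionEdge R B (.inr ⟨s, k.succ⟩) (letterInv (s.letters.get k)) (.inr ⟨s, k.castSucc⟩)

/-- The endpoints of each new path are glued to the states it has to connect. -/
inductive GlueRel (R : Set (InvWord X × InvWord X)) (B : Automaton (X × Bool)) :
    (B.State ⊕ Σ s : ExpansionSite R B, Fin (s.letters.length + 1)) →
    (B.State ⊕ Σ s : ExpansionSite R B, Fin (s.letters.length + 1)) → Prop
  | src (s : ExpansionSite R B) : GlueRel R B (.inl s.src) (.inr ⟨s, 0⟩)
  | tgt (s : ExpansionSite R B) : GlueRel R B (.inl s.tgt) (.inr ⟨s, Fin.last _⟩)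

/-- All the elementary expansions of `B` performed simultaneously: for every instance a new path,
together with the inverse path, is added from `src` to `tgt`. If the word to be adjoined is
empty, this identifies `src` and `tgt`. -/
def expand (R : Set (InvWord X × InvWord X)) (B : Automaton (X × Bool)) :
    Automaton (X × Bool) :=
  identify
    { State := B.State ⊕ Σ s : ExpansionSite R B, Fin (s.letters.length + 1)
      init := Sum.inl '' B.init
      final := Sum.inl '' B.final
      edge := UnionEdge R B }
    (GlueRel R B)

/-- One round of the iterative procedure: all elementary expansions, then all foldings. -/
def stephenStep (R : Set (InvWord X × InvWord X)) (B : Automaton (X × Bool)) :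
    Automaton (X × Bool) := (expand R B).fold

/-- The canonical morphism from an automaton to the result of one round. -/
def toStephenStep (R : Set (InvWord X × InvWord X)) (B : Automaton (X × Bool)) (q : B.State) :
    (stephenStep R B).State := Quot.mk _ (Quot.mk _ (Sum.inl q))

/-- The sequence obtained from `B` by iterating simultaneous expansions and foldings. -/
def stephenSeq (R : Set (InvWord X × InvWord X)) (B : Automaton (X × Bool)) :
    ℕ → Automaton (X × Bool)
  | 0 => B
  | n + 1 => stephenStep R (stephenSeq R B n)

/-- The relation on the disjoint union of the terms of the sequence that identifies each state
with its image in the next term. -/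
def NextRel (R : Set (InvWord X × InvWord X)) (B : Automaton (X × Bool))
    (x y : Σ n, (stephenSeq R B n).State) : Prop :=
  y = ⟨x.1 + 1, toStephenStep R (stephenSeq R B x.1) x.2⟩

/-- The closure `Cl_R(B)`: the colimit of the automata obtained from `B` by elementary expansions
and foldings. It is computed along the sequence in which all of these operations are performed
simultaneously at each round, which is cofinal in the directed system of all finite sequences
of operations. -/
def closure (R : Set (InvWord X × InvWord X)) (B : Automaton (X × Bool)) :
    Automaton (X × Bool) where
  State := Quot (NextRel R B)
  init := {x | ∃ n, ∃ q ∈ (stephenSeq R B n).init, Quot.mk _ ⟨n, q⟩ = x}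
  final := {x | ∃ n, ∃ q ∈ (stephenSeq R B n).final, Quot.mk _ ⟨n, q⟩ = x}
  edge x a y := ∃ n p q, (stephenSeq R B n).edge p a q ∧
    Quot.mk _ ⟨n, p⟩ = x ∧ Quot.mk _ ⟨n, q⟩ = y

end Automaton

/-- The product automaton of a tuple of words: the (inverse, hence trim) automaton obtained from
the Schützenberger automata of the `w i` with respect to `Inv⟨A \ {i} | R θ_i⟩` by adding loops
labelled `i`, `i⁻¹` at all states of the `i`-th one and taking the trim part of the product. -/
def productAutomaton {A : Type u} [DecidableEq A] (R : Set (InvWord A × InvWord A))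
    (w : ∀ i : A, InvWord {a : A // a ≠ i}) : Automaton (A × Bool) :=
  (Automaton.prod fun i : A => (schutzenberger (eraseRel i R) (w i)).addLoops i).trim

/-! ### Inverse monoids -/

/-! Write `P` for the product automaton, `M_i` for the monoid of the erased presentation, and `C_i`
for the closure of the `i`-contraction of `P`. Each closure is deterministic, involutive and
saturated, so words equal in `M_i` label the same paths of `C_i` (`presCon_le_pathCon`). Contraction
and closure also have universal properties (`exists_isHom_contracted`, `exists_isHom_closure`).

Necessity. If `u` maps to the tuple, then `u` labels a successful path of `P`, so `C_i` accepts `u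
θ_i` and hence `w i`. The projection of `P` to its `i`-th coordinate factors through a morphism from
`C_i` to the Schützenberger automaton of `w i`. As `C_i` accepts `w i`, there is also a morphism
back, and the two are mutually inverse (`isomorphic_schutzenberger`).

Sufficiency. The isomorphism gives a loop labelled `w i (w i)⁻¹` at the initial state of `C_i`.
Closure does not enlarge loop languages beyond the natural order: some loop `v_i` at the initial
state of `P` satisfies `v_i θ_i ≤ w i (w i)⁻¹` in `M_i` (`exists_loop_of_closure_loop`, proved by
mapping `C_i` to the coset automaton of a closed inverse submonoid). As `A` is finite, the product
`v` of all `v_i v_i⁻¹` is a loop lying below every `w i (w i)⁻¹` at once. If `z` labels a path from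
the initial to the terminal state of `P`, then `w i = w i (w i)⁻¹ (v z) θ_i = (v z) θ_i` for every
`i`, so `v z` maps to the tuple. -/

theorem letterInv_letterInv {X : Type u} (x : X × Bool) : letterInv (letterInv x) = x := by
  simp [letterInv]

theorem wordInv_of {X : Type u} (x : X × Bool) :
    wordInv (FreeMonoid.of x) = FreeMonoid.of (letterInv x) := rfl

theorem wordInv_wordInv {X : Type u} (w : InvWord X) : wordInv (wordInv w) = w := by
  induction w using FreeMonoid.recOn with
  | one => rfl
  | of_mul x w ih =>
    rw [wordInv_mul, wordInv_mul, ih, wordInv_of, wordInv_of, letterInv_letterInv]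

/-- The axioms of inverse monoids, in terms of a multiplication and a unary operation. -/
class IsInverseMonoid (M : Type*) [Monoid M] [Inv M] : Prop where
  inv_inv (a : M) : a⁻¹⁻¹ = a
  mul_inv_rev (a b : M) : (a * b)⁻¹ = b⁻¹ * a⁻¹
  mul_inv_mul (a : M) : a * a⁻¹ * a = a
  comm (a b : M) : a * a⁻¹ * (b * b⁻¹) = b * b⁻¹ * (a * a⁻¹)

namespace IsInverseMonoid

variable {M : Type*} [Monoid M] [Inv M]

/-- The natural partial order. -/
def NatLE (a b : M) : Prop := ∃ x : M, a = x * x⁻¹ * b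

theorem natLE_mul_inv_mul (x b : M) : NatLE (x * x⁻¹ * b) b := ⟨x, rfl⟩

theorem NatLE.mul_right {b c : M} (h : NatLE b c) (a : M) : NatLE (b * a) (c * a) := by
  obtain ⟨x, rfl⟩ := h
  exact ⟨x, by rw [mul_assoc]⟩

variable [IsInverseMonoid M]

theorem inv_one : (1 : M)⁻¹ = 1 := by
  simpa using mul_inv_mul (1 : M)

theorem comm_inv_mul (a b : M) : a * a⁻¹ * (b⁻¹ * b) = b⁻¹ * b * (a * a⁻¹) := by
  simpa [inv_inv] using comm a b⁻¹

theorem NatLE.refl (a : M) : NatLE a a := ⟨1, by simp [inv_one]⟩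

/-- An idempotent on the right of `b` can be moved to its left. Hence the order, defined through
left idempotents, is compatible with left multiplication and with inversion. -/
theorem mul_mul_inv_eq (b x : M) : b * (x * x⁻¹) = (b * x) * (b * x)⁻¹ * b := by
  calc b * (x * x⁻¹) = b * b⁻¹ * b * (x * x⁻¹) := by rw [mul_inv_mul]
    _ = b * (b⁻¹ * b * (x * x⁻¹)) := by simp only [mul_assoc]
    _ = b * (x * x⁻¹ * (b⁻¹ * b)) := by rw [comm_inv_mul]
    _ = _ := by simp only [mul_assoc, mul_inv_rev]

theorem natLE_mul_mul_inv (b x : M) : NatLE (b * (x * x⁻¹)) b := ⟨b * x, mul_mul_inv_eq b x⟩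

theorem mul_inv_mul_mul_inv (x y : M) :
    x * x⁻¹ * (y * y⁻¹) = (x * x⁻¹ * y) * (x * x⁻¹ * y)⁻¹ := by
  simp only [mul_inv_rev, inv_inv]
  calc x * x⁻¹ * (y * y⁻¹) = x * x⁻¹ * x * x⁻¹ * (y * y⁻¹) := by rw [mul_inv_mul]
    _ = x * x⁻¹ * (x * x⁻¹ * (y * y⁻¹)) := by simp only [mul_assoc]
    _ = x * x⁻¹ * (y * y⁻¹ * (x * x⁻¹)) := by rw [comm]
    _ = _ := by simp only [mul_assoc]

theorem NatLE.trans {a b c : M} (h₁ : NatLE a b) (h₂ : NatLE b c) : NatLE a c := by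
  obtain ⟨x, rfl⟩ := h₁
  obtain ⟨y, rfl⟩ := h₂
  exact ⟨x * x⁻¹ * y, by rw [← mul_inv_mul_mul_inv]; simp only [mul_assoc]⟩

theorem NatLE.mul_left {b c : M} (h : NatLE b c) (a : M) : NatLE (a * b) (a * c) := by
  obtain ⟨x, rfl⟩ := h
  refine ⟨a * x, ?_⟩
  rw [← mul_assoc, mul_mul_inv_eq, mul_assoc _ a c]

theorem NatLE.mul {a b c d : M} (h₁ : NatLE a b) (h₂ : NatLE c d) : NatLE (a * c) (b * d) :=
  (h₁.mul_right c).trans (h₂.mul_left b)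

theorem NatLE.inv {a b : M} (h : NatLE a b) : NatLE a⁻¹ b⁻¹ := by
  obtain ⟨x, rfl⟩ := h
  simpa only [mul_inv_rev, inv_inv] using natLE_mul_mul_inv b⁻¹ x

theorem NatLE.mul_inv_mul_of_mul_inv {a b : M} (h : NatLE a (b * b⁻¹)) : b * b⁻¹ * a = a := by
  obtain ⟨x, rfl⟩ := h
  rw [comm x b, ← mul_assoc (b * b⁻¹) (b * b⁻¹), ← mul_assoc (b * b⁻¹) b b⁻¹, mul_inv_mul]

theorem mul_mul_inv_natLE (m a : M) : NatLE (m * a * (m * a)⁻¹) (m * m⁻¹) := by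
  simpa only [mul_inv_rev, mul_assoc] using (natLE_mul_inv_mul a m⁻¹).mul_left m

theorem greenR_iff {m n : M} : GreenR m n ↔ m * m⁻¹ = n * n⁻¹ := by
  constructor
  · rintro ⟨⟨x, hx⟩, y, hy⟩
    have h₁ : n * n⁻¹ * m = m := by rw [hx, ← mul_assoc, mul_inv_mul]
    have h₂ : m * m⁻¹ * n = n := by rw [hy, ← mul_assoc, mul_inv_mul]
    calc m * m⁻¹ = n * n⁻¹ * m * m⁻¹ := by rw [h₁]
      _ = n * n⁻¹ * (m * m⁻¹) := by rw [mul_assoc]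
      _ = m * m⁻¹ * (n * n⁻¹) := comm _ _
      _ = m * m⁻¹ * n * n⁻¹ := by simp only [mul_assoc]
      _ = n * n⁻¹ := by rw [h₂]
  · intro h
    exact ⟨⟨n⁻¹ * m, by rw [← mul_assoc, ← h, mul_inv_mul]⟩,
      m⁻¹ * n, by rw [← mul_assoc, h, mul_inv_mul]⟩

/-- Right multiplication by `a` is undone by `a⁻¹` as long as it stays in the `𝓡`-class. This makes
the edges of a Schützenberger automaton invertible. -/
theorem mul_mul_inv_cancel {m a : M} (h : m * a * (m * a)⁻¹ = m * m⁻¹) :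
    m * a * a⁻¹ = m := by
  rw [mul_assoc, mul_mul_inv_eq, h, mul_inv_mul]

end IsInverseMonoid

/-! ### Presented monoids are inverse monoids -/

namespace InvPres

variable {X : Type u} {R : Set (InvWord X × InvWord X)}

theorem mul_wordInv_mul (w : InvWord X) :
    (w * wordInv w * w : InvPres R) = (w : InvPres R) :=
  (presCon R).eq.2 (presCon_of_vagnerRel R (.regular w))

theorem mul_wordInv_comm (v w : InvWord X) :
    (v * wordInv v * (w * wordInv w) : InvPres R) = w * wordInv w * (v * wordInv v) :=
  (presCon R).eq.2 (presCon_of_vagnerRel R (.commute v w))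

end InvPres

/-- Uniqueness of inverses: in the quotient, `wordInv v` and `wordInv w` are both inverses `b`, `c`
of one element `a`, and commutation of the idempotents `ab`, `ac` and `ba`, `ca` forces `b = c`. -/
theorem presCon_wordInv {X : Type u} {R : Set (InvWord X × InvWord X)} {v w : InvWord X}
    (h : presCon R v w) : presCon R (wordInv v) (wordInv w) := by
  refine (presCon R).eq.1 ?_
  have ha : (v : InvPres R) = w := (presCon R).eq.2 h
  have hv := InvPres.mul_wordInv_mul (R := R) v
  have hw := InvPres.mul_wordInv_mul (R := R) w
  have hv' := InvPres.mul_wordInv_mul (R := R) (wordInv v)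
  have hw' := InvPres.mul_wordInv_mul (R := R) (wordInv w)
  have h₁ := InvPres.mul_wordInv_comm (R := R) v w
  have h₂ := InvPres.mul_wordInv_comm (R := R) (wordInv v) (wordInv w)
  simp only [wordInv_wordInv] at hv' hw' h₂
  rw [← ha] at hw hw' h₁ h₂
  generalize (v : InvPres R) = a at *
  generalize ((wordInv v : InvWord X) : InvPres R) = b at *
  generalize ((wordInv w : InvWord X) : InvPres R) = c at *
  calc b = b * a * b := hv'.symm
    _ = b * (a * c * a) * b := by rw [hw]
    _ = b * (a * c * (a * b)) := by simp only [mul_assoc]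
    _ = b * (a * b * (a * c)) := by rw [h₁]
    _ = b * (a * b * a) * c := by simp only [mul_assoc]
    _ = b * a * (c * a * c) := by rw [hv, hw']
    _ = b * a * (c * a) * c := by simp only [mul_assoc]
    _ = c * a * (b * a) * c := by rw [h₂]
    _ = c * (a * b * a) * c := by simp only [mul_assoc]
    _ = c := by rw [hv, hw']

namespace InvPres

variable {X : Type u} {R : Set (InvWord X × InvWord X)}

instance : Inv (InvPres R) where
  inv q := Con.liftOn q (fun w => ((wordInv w : InvWord X) : InvPres R))
    fun _ _ h => (presCon R).eq.2 (presCon_wordInv h)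

theorem coe_inv (w : InvWord X) : (w : InvPres R)⁻¹ = ((wordInv w : InvWord X) : InvPres R) := rfl

instance : IsInverseMonoid (InvPres R) where
  inv_inv a := by
    induction a using Con.induction_on with
    | H w => rw [coe_inv, coe_inv, wordInv_wordInv]
  mul_inv_rev a b := by
    induction a using Con.induction_on with
    | H v =>
      induction b using Con.induction_on with
      | H w => rw [← Con.coe_mul, coe_inv, coe_inv, coe_inv, wordInv_mul, Con.coe_mul]
  mul_inv_mul a := by
    induction a using Con.induction_on with
    | H w => exact mul_wordInv_mul w
  comm a b := by
    induction a using Con.induction_on with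
    | H v =>
      induction b using Con.induction_on with
      | H w => exact mul_wordInv_comm v w

end InvPres

/-! ### Paths and morphisms -/

namespace Automaton

section
variable {S : Type u}

theorem reads_nil {B : Automaton S} {p q : B.State} : B.Reads [] p q ↔ p = q := Iff.rfl

theorem reads_cons {B : Automaton S} {a : S} {w : List S} {p q : B.State} :
    B.Reads (a :: w) p q ↔ ∃ r, B.edge p a r ∧ B.Reads w r q := Iff.rfl

theorem reads_append {B : Automaton S} {v w : List S} {p q : B.State} :
    B.Reads (v ++ w) p q ↔ ∃ r, B.Reads v p r ∧ B.Reads w r q := by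
  induction v generalizing p with
  | nil => simp [reads_nil]
  | cons a v ih =>
    simp only [List.cons_append, reads_cons, ih]
    grind

theorem reads_singleton {B : Automaton S} {a : S} {p q : B.State} :
    B.Reads [a] p q ↔ B.edge p a q := by
  simp [reads_cons, reads_nil]

/-- Morphisms of labelled graphs. -/
def IsHom {B C : Automaton S} (f : B.State → C.State) : Prop :=
  ∀ ⦃p a q⦄, B.edge p a q → C.edge (f p) a (f q)

theorem IsHom.reads {B C : Automaton S} {f : B.State → C.State} (hf : IsHom f) {w : List S}
    {p q : B.State} (h : B.Reads w p q) : C.Reads w (f p) (f q) := by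
  induction w generalizing p with
  | nil => exact congrArg f h
  | cons a w ih =>
    obtain ⟨r, h₁, h₂⟩ := h
    exact ⟨f r, hf h₁, ih h₂⟩

/-- At most one edge with a given label leaves a given state. -/
def Deterministic (B : Automaton S) : Prop :=
  ∀ ⦃p a q q'⦄, B.edge p a q → B.edge p a q' → q = q'

theorem Deterministic.reads {B : Automaton S} (hB : B.Deterministic) {w : List S}
    {p q q' : B.State} (h : B.Reads w p q) (h' : B.Reads w p q') : q = q' := by
  induction w generalizing p with
  | nil => exact h.symm.trans h'
  | cons a w ih =>
    obtain ⟨r, h₁, h₂⟩ := h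
    obtain ⟨r', h₁', h₂'⟩ := h'
    obtain rfl := hB h₁ h₁'
    exact ih h₂ h₂'

/-- Every state can be reached from an initial state. -/
def Accessible (B : Automaton S) : Prop := ∀ q, ∃ p ∈ B.init, ∃ w, B.Reads w p q

theorem Reads.exists_path {B : Automaton S} {w : List S} {p q : B.State} (h : B.Reads w p q) :
    ∃ g : Fin (w.length + 1) → B.State, g 0 = p ∧ g (Fin.last _) = q ∧
      ∀ k : Fin w.length, B.edge (g k.castSucc) (w.get k) (g k.succ) := by
  induction w generalizing p with
  | nil => exact ⟨fun _ => p, rfl, h, fun k => k.elim0⟩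
  | cons a w ih =>
    obtain ⟨r, h₁, h₂⟩ := h
    obtain ⟨g, h0, hl, hg⟩ := ih h₂
    refine ⟨Fin.cons p g, rfl, ?_, ?_⟩
    · rw [← hl]
      rfl
    · intro k
      refine Fin.cases ?_ (fun k => ?_) k
      · subst h0
        exact h₁
      · exact hg k

theorem reads_take_of_path {B : Automaton S} {w : List S} {g : Fin (w.length + 1) → B.State}
    (hg : ∀ k : Fin w.length, B.edge (g k.castSucc) (w.get k) (g k.succ))
    (k : Fin (w.length + 1)) : B.Reads (w.take k) (g 0) (g k) := by
  induction k using Fin.induction with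
  | zero => simp [reads_nil]
  | succ k ih =>
    have : w.take (k.succ : ℕ) = w.take (k.castSucc : ℕ) ++ [w.get k] := by
      simp
    rw [this, reads_append]
    exact ⟨_, ih, reads_singleton.2 (hg k)⟩

theorem reads_of_path {B : Automaton S} {w : List S} {g : Fin (w.length + 1) → B.State}
    (hg : ∀ k : Fin w.length, B.edge (g k.castSucc) (w.get k) (g k.succ)) :
    B.Reads w (g 0) (g (Fin.last _)) := by
  simpa using reads_take_of_path hg (Fin.last _)

theorem isHom_identify (B : Automaton S) (r : B.State → B.State → Prop) :
    IsHom (C := B.identify r) (Quot.mk r) :=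
  fun p _ q h => ⟨p, q, h, rfl, rfl⟩

theorem isHom_identify_lift {B C : Automaton S} {r : B.State → B.State → Prop}
    {f : B.State → C.State} (hf : IsHom f) (hr : ∀ p q, r p q → f p = f q) :
    IsHom (B := B.identify r) (C := C) (Quot.lift f hr) := by
  rintro _ a _ ⟨p, q, h, rfl, rfl⟩
  exact hf h

/-- The universal property of folding. -/
theorem FoldRel.map_eq {B C : Automaton S} (hC : C.Deterministic) {f : B.State → C.State}
    (hf : IsHom f) {p q : B.State} (h : B.FoldRel p q) : f p = f q := by
  induction h with
  | refl => rfl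
  | symm _ ih => exact ih.symm
  | trans _ _ ih₁ ih₂ => exact ih₁.trans ih₂
  | fold _ h₁ h₂ ih => exact hC (hf h₁) (ih ▸ hf h₂)

theorem foldRel_of_mk_eq {B : Automaton S} {p q : B.State}
    (h : Quot.mk B.FoldRel p = Quot.mk B.FoldRel q) : B.FoldRel p q := by
  have he : Equivalence B.FoldRel := ⟨.refl, .symm, .trans⟩
  exact (Equivalence.quot_mk_eq_iff he p q).1 h

/-- One quotient suffices, since `FoldRel` already contains every identification that earlier
identifications make necessary. -/
theorem deterministic_fold (B : Automaton S) : B.fold.Deterministic := by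
  rintro _ a _ _ ⟨p, q, h, rfl, rfl⟩ ⟨p', q', h', hp, rfl⟩
  exact Quot.sound (.fold (foldRel_of_mk_eq hp.symm) h h')

theorem Accessible.identify {B : Automaton S} (hB : B.Accessible)
    (r : B.State → B.State → Prop) : (B.identify r).Accessible := by
  rintro ⟨q⟩
  obtain ⟨p, hp, w, hw⟩ := hB q
  exact ⟨_, ⟨p, hp, rfl⟩, w, (isHom_identify B r).reads hw⟩

end

variable {X : Type u}

/-- Edges come in mutually inverse pairs. -/
def Involutive (B : Automaton (X × Bool)) : Prop :=
  ∀ ⦃p a q⦄, B.edge p a q → B.edge q (letterInv a) p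

theorem reads_mul {B : Automaton (X × Bool)} {v w : InvWord X} {p q : B.State} :
    B.Reads (v * w).toList p q ↔ ∃ r, B.Reads v.toList p r ∧ B.Reads w.toList r q := by
  rw [FreeMonoid.toList_mul, reads_append]

theorem reads_of {B : Automaton (X × Bool)} {x : X × Bool} {p q : B.State} :
    B.Reads (FreeMonoid.of x).toList p q ↔ B.edge p x q := reads_singleton

theorem reads_one {B : Automaton (X × Bool)} {p q : B.State} :
    B.Reads (1 : InvWord X).toList p q ↔ p = q := Iff.rfl

theorem Involutive.reads {B : Automaton (X × Bool)} (hB : B.Involutive) {w : InvWord X}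
    {p q : B.State} (h : B.Reads w.toList p q) : B.Reads (wordInv w).toList q p := by
  induction w using FreeMonoid.recOn generalizing p with
  | one => exact h.symm
  | of_mul x w ih =>
    obtain ⟨r, h₁, h₂⟩ := reads_mul.1 h
    rw [wordInv_mul, wordInv_of]
    exact reads_mul.2 ⟨r, ih h₂, reads_of.2 (hB (reads_of.1 h₁))⟩

theorem Involutive.identify {B : Automaton (X × Bool)} (hB : B.Involutive)
    (r : B.State → B.State → Prop) : (B.identify r).Involutive := by
  rintro _ a _ ⟨p, q, h, rfl, rfl⟩
  exact ⟨q, p, hB h, rfl, rfl⟩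

/-- The two sides of every relation in `R` label the same paths. -/
def Saturated (R : Set (InvWord X × InvWord X)) (B : Automaton (X × Bool)) : Prop :=
  ∀ r ∈ R, ∀ p q, B.Reads r.1.toList p q ↔ B.Reads r.2.toList p q

/-- The congruence of words labelling the same paths. -/
def pathCon (B : Automaton (X × Bool)) : Con (InvWord X) where
  r v w := ∀ p q, B.Reads v.toList p q ↔ B.Reads w.toList p q
  iseqv := ⟨fun _ _ _ => Iff.rfl, fun h p q => (h p q).symm,
    fun h h' p q => (h p q).trans (h' p q)⟩
  mul' h h' p q := by simp only [reads_mul, h _ _, h' _ _]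

/-- Words act on the states as partial injections, and `w w⁻¹` acts as the identity on the domain of
`w`. Partial identities commute, which is why the Vagner relations hold for paths. -/
theorem reads_mul_wordInv {B : Automaton (X × Bool)} (hd : B.Deterministic) (hi : B.Involutive)
    {w : InvWord X} {p q : B.State} :
    B.Reads (w * wordInv w).toList p q ↔ p = q ∧ ∃ r, B.Reads w.toList p r := by
  rw [reads_mul]
  constructor
  · rintro ⟨r, h₁, h₂⟩
    exact ⟨hd.reads (hi.reads h₁) h₂, r, h₁⟩
  · rintro ⟨rfl, r, h⟩
    exact ⟨r, h, hi.reads h⟩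

theorem vagnerCon_le_pathCon {B : Automaton (X × Bool)} (hd : B.Deterministic)
    (hi : B.Involutive) : vagnerCon X ≤ B.pathCon := by
  refine Con.conGen_le.2 ?_
  intro v w h p q
  cases h with
  | regular =>
    simp only [reads_mul (v := w * wordInv w), reads_mul_wordInv hd hi]
    grind
  | commute v w =>
    simp only [reads_mul (v := w * wordInv w), reads_mul (v := v * wordInv v),
      reads_mul_wordInv hd hi]
    grind

theorem presCon_le_pathCon {R : Set (InvWord X × InvWord X)} {B : Automaton (X × Bool)}
    (hd : B.Deterministic) (hi : B.Involutive) (hs : B.Saturated R) :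
    presCon R ≤ B.pathCon := by
  refine Con.conGen_le.2 ?_
  rintro v w (h | h)
  · exact vagnerCon_le_pathCon hd hi h
  · exact hs _ h

end Automaton

namespace Automaton

/-! ### The closure -/

section
variable {X : Type u} {R : Set (InvWord X × InvWord X)} {B : Automaton (X × Bool)}

theorem involutive_expand (hB : B.Involutive) : (expand R B).Involutive := by
  refine Involutive.identify ?_ _
  rintro _ _ _ (h | ⟨s, k⟩ | ⟨s, k⟩)
  · exact .old (hB h)
  · exact .backward s k
  · rw [letterInv_letterInv]
    exact .forward s k

theorem involutive_stephenStep (hB : B.Involutive) : (stephenStep R B).Involutive :=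
  (involutive_expand hB).identify _

/-- The canonical morphism to the automaton with all elementary expansions performed. -/
def toExpand (R : Set (InvWord X × InvWord X)) (B : Automaton (X × Bool)) (q : B.State) :
    (expand R B).State := Quot.mk _ (Sum.inl q)

theorem isHom_toExpand : IsHom (toExpand R B) :=
  fun p _ q h => ⟨.inl p, .inl q, .old h, rfl, rfl⟩

theorem isHom_toStephenStep : IsHom (toStephenStep R B) :=
  fun _ _ _ h => isHom_identify _ _ (isHom_toExpand h)

/-- The states of the path adjoined at an expansion site. -/
def sitePath (s : ExpansionSite R B) (k : Fin (s.letters.length + 1)) : (expand R B).State :=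
  Quot.mk _ (Sum.inr ⟨s, k⟩)

theorem sitePath_zero (s : ExpansionSite R B) : sitePath s 0 = toExpand R B s.src :=
  (Quot.sound (.src s)).symm

theorem sitePath_last (s : ExpansionSite R B) : sitePath s (Fin.last _) = toExpand R B s.tgt :=
  (Quot.sound (.tgt s)).symm

theorem edge_sitePath (s : ExpansionSite R B) (k : Fin s.letters.length) :
    (expand R B).edge (sitePath s k.castSucc) (s.letters.get k) (sitePath s k.succ) :=
  ⟨_, _, .forward s k, rfl, rfl⟩

theorem reads_toExpand (s : ExpansionSite R B) :
    (expand R B).Reads s.added.toList (toExpand R B s.src) (toExpand R B s.tgt) := by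
  rw [← sitePath_zero, ← sitePath_last]
  exact reads_of_path (edge_sitePath s)

theorem reads_toStephenStep (s : ExpansionSite R B) :
    (stephenStep R B).Reads s.added.toList (toStephenStep R B s.src)
      (toStephenStep R B s.tgt) :=
  (isHom_identify _ _).reads (reads_toExpand s)

theorem accessible_expand (hB : B.Accessible) : (expand R B).Accessible := by
  have key : ∀ q : B.State, ∃ p ∈ (expand R B).init, ∃ w,
      (expand R B).Reads w p (toExpand R B q) := by
    intro q
    obtain ⟨p, hp, w, hw⟩ := hB q
    exact ⟨_, ⟨_, ⟨p, hp, rfl⟩, rfl⟩, w, isHom_toExpand.reads hw⟩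
  rintro ⟨q | ⟨s, k⟩⟩
  · exact key q
  · obtain ⟨p, hp, w, hw⟩ := key s.src
    refine ⟨p, hp, w ++ s.letters.take k, reads_append.2 ⟨_, hw, ?_⟩⟩
    rw [← sitePath_zero]
    exact reads_take_of_path (edge_sitePath s) k

theorem accessible_stephenStep (hB : B.Accessible) : (stephenStep R B).Accessible :=
  (accessible_expand hB).identify _

/-- The universal property of one round: saturation of `C` provides an image for each adjoined path,
involutivity for its inverse path, and determinism lets the map pass to the folding. -/
theorem exists_isHom_stephenStep {C : Automaton (X × Bool)} (hd : C.Deterministic)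
    (hi : C.Involutive) (hs : C.Saturated R) {f : B.State → C.State} (hf : IsHom f) :
    ∃ g : (stephenStep R B).State → C.State, IsHom g ∧ ∀ q, g (toStephenStep R B q) = f q := by
  have hpath : ∀ s : ExpansionSite R B, ∃ g : Fin (s.letters.length + 1) → C.State,
      g 0 = f s.src ∧ g (Fin.last _) = f s.tgt ∧
        ∀ k : Fin s.letters.length, C.edge (g k.castSucc) (s.letters.get k) (g k.succ) := by
    intro s
    refine Reads.exists_path ?_
    have h := hf.reads s.path
    rcases s.rel with hr | hr
    · exact (hs _ hr _ _).2 h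
    · exact (hs _ hr _ _).1 h
  choose g h0 hl hg using hpath
  let F : (expand R B).State → C.State := Quot.lift (Sum.elim f fun x => g x.1 x.2) (by
    rintro _ _ (s | s)
    · exact (h0 s).symm
    · exact (hl s).symm)
  have hF : IsHom F := by
    refine isHom_identify_lift ?_ _
    rintro _ _ _ (h | ⟨s, k⟩ | ⟨s, k⟩)
    · exact hf h
    · exact hg s k
    · exact hi (hg s k)
  exact ⟨Quot.lift F fun p q h => h.map_eq hd hF, isHom_identify_lift hF _, fun q => rfl⟩

/-! ### The colimit of the stages -/

variable (R B)

/-- The disjoint union of the terms of the sequence. -/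
abbrev StageState : Type u := Σ n, (stephenSeq R B n).State

variable {R B}

/-- The canonical morphism to the next term of the sequence. -/
def nextStage (x : StageState R B) : StageState R B :=
  ⟨x.1 + 1, toStephenStep R (stephenSeq R B x.1) x.2⟩

/-- The image of a state in the colimit. -/
def toColimit (x : StageState R B) : (closure R B).State := Quot.mk _ x

/-- Paths within one term of the sequence. -/
def StageReads (w : List (X × Bool)) (x y : StageState R B) : Prop :=
  ∃ n p q, x = ⟨n, p⟩ ∧ y = ⟨n, q⟩ ∧ (stephenSeq R B n).Reads w p q

theorem toColimit_nextStage (x : StageState R B) : toColimit (nextStage x) = toColimit x :=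
  (Quot.sound (r := NextRel R B) (b := nextStage x) rfl).symm

theorem toColimit_iterate (k : ℕ) (x : StageState R B) :
    toColimit (nextStage^[k] x) = toColimit x := by
  induction k with
  | zero => rfl
  | succ k ih => rw [Function.iterate_succ_apply', toColimit_nextStage, ih]

/-- `NextRel` is the graph of a function, so equivalent states have a common forward image. -/
theorem exists_iterate_eq {x y : StageState R B} (h : toColimit x = toColimit y) :
    ∃ k l, nextStage^[k] x = nextStage^[l] y := by
  replace h : Relation.EqvGen (NextRel R B) x y := Quot.eqvGen_exact h
  induction h with
  | rel x y h => exact ⟨1, 0, h.symm⟩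
  | refl x => exact ⟨0, 0, rfl⟩
  | symm x y _ ih =>
    obtain ⟨k, l, h⟩ := ih
    exact ⟨l, k, h.symm⟩
  | trans x y z _ _ ih₁ ih₂ =>
    obtain ⟨k, l, h⟩ := ih₁
    obtain ⟨m, o, h'⟩ := ih₂
    refine ⟨m + k, l + o, ?_⟩
    rw [Function.iterate_add_apply, h, ← Function.iterate_add_apply, add_comm,
      Function.iterate_add_apply, h', ← Function.iterate_add_apply]

theorem StageReads.next {w : List (X × Bool)} {x y : StageState R B} (h : StageReads w x y) :
    StageReads w (nextStage x) (nextStage y) := by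
  obtain ⟨n, p, q, rfl, rfl, h⟩ := h
  exact ⟨n + 1, _, _, rfl, rfl, isHom_toStephenStep.reads h⟩

theorem StageReads.iterate {w : List (X × Bool)} {x y : StageState R B} (h : StageReads w x y)
    (k : ℕ) : StageReads w (nextStage^[k] x) (nextStage^[k] y) := by
  induction k with
  | zero => exact h
  | succ k ih =>
    rw [Function.iterate_succ_apply', Function.iterate_succ_apply']
    exact ih.next

theorem StageReads.append {v w : List (X × Bool)} {x y z : StageState R B}
    (h : StageReads v x y) (h' : StageReads w y z) : StageReads (v ++ w) x z := by
  obtain ⟨n, p, q, rfl, rfl, h⟩ := h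
  obtain ⟨m, q', r, hq, rfl, h'⟩ := h'
  cases hq
  exact ⟨n, p, r, rfl, rfl, reads_append.2 ⟨q, h, h'⟩⟩

theorem StageReads.toColimit {w : List (X × Bool)} {x y : StageState R B}
    (h : StageReads w x y) : (closure R B).Reads w (toColimit x) (toColimit y) := by
  obtain ⟨n, p, q, rfl, rfl, h⟩ := h
  exact IsHom.reads (f := fun p => Automaton.toColimit ⟨n, p⟩)
    (fun p _ q h => ⟨n, p, q, h, rfl, rfl⟩) h

theorem edge_closure_iff {x y : (closure R B).State} {a : X × Bool} :
    (closure R B).edge x a y ↔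
      ∃ x' y', toColimit x' = x ∧ toColimit y' = y ∧ StageReads [a] x' y' := by
  constructor
  · rintro ⟨n, p, q, h, hx, hy⟩
    exact ⟨⟨n, p⟩, ⟨n, q⟩, hx, hy, n, p, q, rfl, rfl, reads_singleton.2 h⟩
  · rintro ⟨x', y', rfl, rfl, h⟩
    exact reads_singleton.1 h.toColimit

/-- A path has finitely many edges, so pushing them forward brings them all to one stage, where
consecutive endpoints agree. -/
theorem exists_stageReads {w : List (X × Bool)} {x y : (closure R B).State}
    (h : (closure R B).Reads w x y) :
    ∃ x' y', toColimit x' = x ∧ toColimit y' = y ∧ StageReads w x' y' := by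
  induction w generalizing x with
  | nil =>
    obtain rfl := reads_nil.1 h
    obtain ⟨⟨n, p⟩, rfl⟩ := Quot.exists_rep x
    exact ⟨⟨n, p⟩, ⟨n, p⟩, rfl, rfl, n, p, p, rfl, rfl, rfl⟩
  | cons a w ih =>
    obtain ⟨r, h₁, h₂⟩ := h
    obtain ⟨x₁, r₁, rfl, rfl, e₁⟩ := edge_closure_iff.1 h₁
    obtain ⟨r₂, y₂, hr, rfl, e₂⟩ := ih h₂
    obtain ⟨k, l, hkl⟩ := exists_iterate_eq hr
    refine ⟨nextStage^[l] x₁, nextStage^[k] y₂, toColimit_iterate _ _, toColimit_iterate _ _,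
      (e₁.iterate l).append ?_⟩
    rw [← hkl]
    exact e₂.iterate k

theorem deterministic_closure : (closure R B).Deterministic := by
  intro x a y z h₁ h₂
  obtain ⟨x₁, y, rfl, rfl, e₁⟩ := edge_closure_iff.1 h₁
  obtain ⟨x₂, z, hx, rfl, e₂⟩ := edge_closure_iff.1 h₂
  obtain ⟨k, l, hkl⟩ := exists_iterate_eq hx
  replace e₁ := e₁.iterate l
  replace e₂ := e₂.iterate k
  rw [hkl] at e₂
  clear h₁ h₂
  rw [← toColimit_iterate l y, ← toColimit_iterate k z]
  generalize nextStage^[l] x₁ = x, nextStage^[l] y = y, nextStage^[k] z = z at *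
  obtain ⟨n, p, q, rfl, rfl, h₁⟩ := e₁
  obtain ⟨m, p', q', hp, rfl, h₂⟩ := e₂
  cases hp
  -- Stage `n` need not be folded when `n = 0`; stage `n + 1` always is.
  rw [← toColimit_nextStage, ← toColimit_nextStage ⟨n, q'⟩]
  exact congrArg (fun q => toColimit ⟨n + 1, q⟩) ((deterministic_fold _).reads
    (isHom_toStephenStep.reads h₁) (isHom_toStephenStep.reads h₂))

theorem involutive_stephenSeq (hB : B.Involutive) (n : ℕ) : (stephenSeq R B n).Involutive := by
  induction n with
  | zero => exact hB
  | succ n ih => exact involutive_stephenStep ih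

theorem involutive_closure (hB : B.Involutive) : (closure R B).Involutive := by
  rintro x a y ⟨n, p, q, h, hx, hy⟩
  exact ⟨n, q, p, involutive_stephenSeq hB n h, hy, hx⟩

theorem accessible_stephenSeq (hB : B.Accessible) (n : ℕ) : (stephenSeq R B n).Accessible := by
  induction n with
  | zero => exact hB
  | succ n ih => exact accessible_stephenStep ih

theorem accessible_closure (hB : B.Accessible) : (closure R B).Accessible := by
  rintro ⟨n, q⟩
  obtain ⟨p, hp, w, hw⟩ := accessible_stephenSeq hB n q
  exact ⟨toColimit ⟨n, p⟩, ⟨n, p, hp, rfl⟩, w,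
    StageReads.toColimit ⟨n, p, q, rfl, rfl, hw⟩⟩

/-- The given path already exists at some stage, hence is an expansion site there, and the next
round adjoins the other side of the relation. -/
theorem closure_reads_of_rel {u v : InvWord X} (hr : (u, v) ∈ R ∨ (v, u) ∈ R)
    {x y : (closure R B).State} (h : (closure R B).Reads v.toList x y) :
    (closure R B).Reads u.toList x y := by
  obtain ⟨_, _, rfl, rfl, n, p, q, rfl, rfl, h'⟩ := exists_stageReads h
  rw [← toColimit_nextStage, ← toColimit_nextStage ⟨n, q⟩]
  exact StageReads.toColimit ⟨n + 1, _, _, rfl, rfl, reads_toStephenStep ⟨u, v, p, q, hr, h'⟩⟩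

theorem saturated_closure : (closure R B).Saturated R :=
  fun _ hr _ _ => ⟨closure_reads_of_rel (.inr hr), closure_reads_of_rel (.inl hr)⟩

/-- The canonical morphism from an automaton to its closure. -/
def toClosure (R : Set (InvWord X × InvWord X)) (B : Automaton (X × Bool)) (q : B.State) :
    (closure R B).State := toColimit ⟨0, q⟩

theorem isHom_toClosure : IsHom (toClosure R B) :=
  fun p _ q h => ⟨0, p, q, h, rfl, rfl⟩

theorem exists_toClosure_of_mem_init {x : (closure R B).State} (hx : x ∈ (closure R B).init) :
    ∃ q ∈ B.init, toClosure R B q = x := by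
  obtain ⟨n, q, hq, rfl⟩ := hx
  induction n with
  | zero => exact ⟨q, hq, rfl⟩
  | succ n ih =>
    obtain ⟨_, ⟨_, ⟨q, hq, rfl⟩, rfl⟩, rfl⟩ := hq
    obtain ⟨q', hq', h⟩ := ih q hq
    exact ⟨q', hq', h.trans (toColimit_nextStage ⟨n, q⟩).symm⟩

theorem exists_toClosure_of_mem_final {x : (closure R B).State}
    (hx : x ∈ (closure R B).final) : ∃ q ∈ B.final, toClosure R B q = x := by
  obtain ⟨n, q, hq, rfl⟩ := hx
  induction n with
  | zero => exact ⟨q, hq, rfl⟩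
  | succ n ih =>
    obtain ⟨_, ⟨_, ⟨q, hq, rfl⟩, rfl⟩, rfl⟩ := hq
    obtain ⟨q', hq', h⟩ := ih q hq
    exact ⟨q', hq', h.trans (toColimit_nextStage ⟨n, q⟩).symm⟩

theorem closure_init : (closure R B).init = toClosure R B '' B.init :=
  Set.Subset.antisymm (fun _ hx => exists_toClosure_of_mem_init hx)
    (Set.image_subset_iff.2 fun q hq => ⟨0, q, hq, rfl⟩)

theorem closure_final : (closure R B).final = toClosure R B '' B.final :=
  Set.Subset.antisymm (fun _ hx => exists_toClosure_of_mem_final hx)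
    (Set.image_subset_iff.2 fun q hq => ⟨0, q, hq, rfl⟩)

/-- The universal property of the closure: morphisms are extended round by round, and the compatible
extensions glue on the colimit. -/
theorem exists_isHom_closure {C : Automaton (X × Bool)} (hd : C.Deterministic)
    (hi : C.Involutive) (hs : C.Saturated R) {f : B.State → C.State} (hf : IsHom f) :
    ∃ g : (closure R B).State → C.State, IsHom g ∧ ∀ q, g (toClosure R B q) = f q := by
  choose e he he' using fun (n : ℕ) (f : {f : (stephenSeq R B n).State → C.State // IsHom f}) =>
    exists_isHom_stephenStep (R := R) hd hi hs f.2
  let F : ∀ n, {f : (stephenSeq R B n).State → C.State // IsHom f} := fun n =>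
    Nat.rec ⟨f, hf⟩ (fun n g => ⟨e n g, he n g⟩) n
  refine ⟨Quot.lift (fun x : StageState R B => (F x.1).1 x.2) ?_, ?_, fun q => rfl⟩
  · rintro ⟨n, p⟩ _ rfl
    exact (he' n (F n) p).symm
  · rintro _ a _ ⟨n, p, q, h, rfl, rfl⟩
    exact (F n).2 h

end

end Automaton

/-! ### Coset automata of closed inverse submonoids -/

open IsInverseMonoid (NatLE natLE_mul_mul_inv mul_mul_inv_natLE greenR_iff mul_mul_inv_cancel
  mul_inv_mul)

/-- Inverse submonoids that are upward closed for the natural partial order. -/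
structure ClosedInverseSubmonoid (M : Type*) [Monoid M] [Inv M] extends Submonoid M where
  inv_mem {a : M} : a ∈ carrier → a⁻¹ ∈ carrier
  up {a b : M} : a ∈ carrier → NatLE a b → b ∈ carrier

namespace ClosedInverseSubmonoid

section
variable {M : Type*} [Monoid M] [Inv M] [IsInverseMonoid M] (H : ClosedInverseSubmonoid M)

/-- `a b⁻¹ b c⁻¹ ≤ a c⁻¹`, so upward closure is what makes the coset relation transitive. -/
theorem mul_inv_mem_trans {a b c : M} (h : a * b⁻¹ ∈ H.toSubmonoid)
    (h' : b * c⁻¹ ∈ H.toSubmonoid) : a * c⁻¹ ∈ H.toSubmonoid := by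
  refine H.up (H.mul_mem h h') ?_
  have := (natLE_mul_mul_inv a b⁻¹).mul_right c⁻¹
  simpa only [IsInverseMonoid.inv_inv, mul_assoc] using this

theorem mul_inv_mem_symm {a b : M} (h : a * b⁻¹ ∈ H.toSubmonoid) :
    b * a⁻¹ ∈ H.toSubmonoid := by
  have := H.inv_mem h
  rwa [IsInverseMonoid.mul_inv_rev, IsInverseMonoid.inv_inv] at this

/-- The elements defining a right coset of `H`. -/
abbrev Dom : Type _ := {m : M // m * m⁻¹ ∈ H.toSubmonoid}

/-- Two elements define the same right coset of `H`. -/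
def CosetRel (m n : H.Dom) : Prop := m.1 * n.1⁻¹ ∈ H.toSubmonoid

theorem equivalence_cosetRel : Equivalence H.CosetRel :=
  ⟨fun m => m.2, H.mul_inv_mem_symm, H.mul_inv_mem_trans⟩

theorem mul_mul_inv_mem {m n a : M} (h : m * n⁻¹ ∈ H.toSubmonoid)
    (hn : n * a * (n * a)⁻¹ ∈ H.toSubmonoid) : m * a * (n * a)⁻¹ ∈ H.toSubmonoid := by
  refine H.up (H.mul_mem h hn) ?_
  have := (natLE_mul_mul_inv m n⁻¹).mul_right (a * (n * a)⁻¹)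
  simpa only [IsInverseMonoid.inv_inv, mul_assoc] using this

theorem mem_of_mul_mem {m a : M} (h : m * a * (m * a)⁻¹ ∈ H.toSubmonoid) :
    m * m⁻¹ ∈ H.toSubmonoid :=
  H.up h (mul_mul_inv_natLE m a)

end

section
variable {X : Type u} {R : Set (InvWord X × InvWord X)} (H : ClosedInverseSubmonoid (InvPres R))

/-- The automaton whose states are the right cosets of `H` and whose language is `H`. -/
def cosetAutomaton : Automaton (X × Bool) :=
  Automaton.identify
    { State := H.Dom
      init := {m | m.1 = 1}
      final := {m | m.1 ∈ H.toSubmonoid}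
      edge := fun m x n => n.1 = m.1 * ((FreeMonoid.of x : InvWord X) : InvPres R) }
    H.CosetRel

/-- The right coset of `H` defined by an element. -/
def coset (m : InvPres R) (h : m * m⁻¹ ∈ H.toSubmonoid) : H.cosetAutomaton.State :=
  Quot.mk _ ⟨m, h⟩

variable {H}

theorem coset_eq_iff {m n : InvPres R} {hm : m * m⁻¹ ∈ H.toSubmonoid}
    {hn : n * n⁻¹ ∈ H.toSubmonoid} : H.coset m hm = H.coset n hn ↔ m * n⁻¹ ∈ H.toSubmonoid :=
  Equivalence.quot_mk_eq_iff H.equivalence_cosetRel _ _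

theorem exists_coset (x : H.cosetAutomaton.State) : ∃ m h, H.coset m h = x := by
  obtain ⟨⟨m, h⟩, rfl⟩ := Quot.exists_rep x
  exact ⟨m, h, rfl⟩

theorem edge_coset_iff {m : InvPres R} {hm : m * m⁻¹ ∈ H.toSubmonoid} {x : X × Bool}
    {r : H.cosetAutomaton.State} :
    H.cosetAutomaton.edge (H.coset m hm) x r ↔
      ∃ h, H.coset (m * ((FreeMonoid.of x : InvWord X) : InvPres R)) h = r := by
  constructor
  · rintro ⟨⟨m', hm'⟩, ⟨_, hn⟩, rfl, h, rfl⟩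
    have h₁ : m * m'⁻¹ ∈ H.toSubmonoid := (coset_eq_iff (hm := hm) (hn := hm')).1 h.symm
    have h₂ := H.mul_mul_inv_mem h₁ hn
    -- The target of the edge is a coset only if `(m x)(m x)⁻¹` lies in `H`; this follows from
    -- transitivity through `m' x`.
    have h₃ := H.mul_inv_mem_trans h₂ (H.mul_inv_mem_symm h₂)
    exact ⟨h₃, (coset_eq_iff (hn := hn)).2 h₂⟩
  · rintro ⟨h, rfl⟩
    exact ⟨⟨m, hm⟩, ⟨_, h⟩, rfl, rfl, rfl⟩

theorem reads_coset_iff {m : InvPres R} {hm : m * m⁻¹ ∈ H.toSubmonoid} {w : InvWord X}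
    {r : H.cosetAutomaton.State} :
    H.cosetAutomaton.Reads w.toList (H.coset m hm) r ↔ ∃ h, H.coset (m * w) h = r := by
  induction w using FreeMonoid.recOn generalizing m with
  | one =>
    rw [Automaton.reads_one]
    simp [hm]
  | of_mul x w ih =>
    simp only [Automaton.reads_mul, Automaton.reads_of, edge_coset_iff, Con.coe_mul, ← mul_assoc]
    constructor
    · rintro ⟨_, ⟨h, rfl⟩, h'⟩
      exact ih.1 h'
    · rintro ⟨h, rfl⟩
      have := H.mem_of_mul_mem h
      exact ⟨_, ⟨this, rfl⟩, ih.2 ⟨h, rfl⟩⟩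

theorem deterministic_cosetAutomaton : H.cosetAutomaton.Deterministic := by
  intro p x q q' h h'
  obtain ⟨m, hm, rfl⟩ := exists_coset p
  obtain ⟨_, rfl⟩ := edge_coset_iff.1 h
  obtain ⟨_, rfl⟩ := edge_coset_iff.1 h'
  rfl

theorem involutive_cosetAutomaton : H.cosetAutomaton.Involutive := by
  intro p x q h
  obtain ⟨m, hm, rfl⟩ := exists_coset p
  obtain ⟨h', rfl⟩ := edge_coset_iff.1 h
  -- The element is `(m x)(m x)⁻¹`; read as `(m x x⁻¹) m⁻¹`, it says that `m x x⁻¹` and `m` define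
  -- the same coset.
  have h₁ : m * ((FreeMonoid.of x : InvWord X) : InvPres R) *
      ((FreeMonoid.of (letterInv x) : InvWord X) : InvPres R) * m⁻¹ ∈ H.toSubmonoid := by
    rw [IsInverseMonoid.mul_inv_rev, ← mul_assoc] at h'
    exact h'
  have h₂ := H.mul_inv_mem_trans h₁ (H.mul_inv_mem_symm h₁)
  exact edge_coset_iff.2 ⟨h₂, coset_eq_iff.2 h₁⟩

theorem saturated_cosetAutomaton : H.cosetAutomaton.Saturated R := by
  intro r hr p q
  obtain ⟨m, hm, rfl⟩ := exists_coset p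
  have : (r.1 : InvPres R) = r.2 := (presCon R).eq.2 (ConGen.Rel.of _ _ (Or.inr hr))
  rw [reads_coset_iff, reads_coset_iff, this]

theorem mem_of_reads_coset_one {w : InvWord X} {h : (1 : InvPres R) * 1⁻¹ ∈ H.toSubmonoid}
    (hw : H.cosetAutomaton.Reads w.toList (H.coset 1 h) (H.coset 1 h)) :
    (w : InvPres R) ∈ H.toSubmonoid := by
  obtain ⟨h', e⟩ := reads_coset_iff.1 hw
  simpa [IsInverseMonoid.inv_one] using coset_eq_iff.1 e

end

end ClosedInverseSubmonoid

/-! ### Schützenberger automata -/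

namespace Automaton

section
variable {X : Type u} {R : Set (InvWord X × InvWord X)} {w : InvWord X}

theorem schutzenberger_state_mul_inv (m : (schutzenberger R w).State) :
    m.1 * m.1⁻¹ = (w : InvPres R) * (w : InvPres R)⁻¹ := greenR_iff.1 m.2

theorem deterministic_schutzenberger : (schutzenberger R w).Deterministic :=
  fun _ _ _ _ h h' => Subtype.ext (h.trans h'.symm)

theorem involutive_schutzenberger : (schutzenberger R w).Involutive := by
  intro p x q h
  change q.1 = p.1 * _ at h
  change p.1 = q.1 * ((FreeMonoid.of x : InvWord X) : InvPres R)⁻¹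
  rw [h, mul_mul_inv_cancel]
  rw [← h, schutzenberger_state_mul_inv, schutzenberger_state_mul_inv]

theorem reads_schutzenberger_iff {v : InvWord X} {p q : (schutzenberger R w).State} :
    (schutzenberger R w).Reads v.toList p q ↔ q.1 = p.1 * (v : InvPres R) := by
  induction v using FreeMonoid.recOn generalizing p with
  | one =>
    rw [reads_one, Con.coe_one, mul_one]
    exact ⟨fun h => congrArg _ h.symm, fun h => Subtype.ext h.symm⟩
  | of_mul x v ih =>
    rw [reads_mul, Con.coe_mul, ← mul_assoc]
    constructor
    · rintro ⟨r, h, h'⟩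
      rw [reads_of] at h
      change r.1 = _ at h
      rw [← h]
      exact ih.1 h'
    · intro h
      -- An intermediate element lies between `p` and `q` in the `𝓡`-order, hence in their
      -- `𝓡`-class.
      have hp : GreenR (p.1 * ((FreeMonoid.of x : InvWord X) : InvPres R)) (w : InvPres R) := by
        obtain ⟨⟨a, ha⟩, _⟩ := p.2
        obtain ⟨_, b, hb⟩ := q.2
        refine ⟨⟨a * ((FreeMonoid.of x : InvWord X) : InvPres R), ?_⟩, v * b, ?_⟩
        · rw [← mul_assoc, ← ha]
        · rw [← mul_assoc, ← h, ← hb]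
      exact ⟨⟨_, hp⟩, reads_of.2 rfl, ih.2 h⟩

theorem saturated_schutzenberger : (schutzenberger R w).Saturated R := by
  intro r hr p q
  have : (r.1 : InvPres R) = r.2 := (presCon R).eq.2 (ConGen.Rel.of _ _ (Or.inr hr))
  rw [reads_schutzenberger_iff, reads_schutzenberger_iff, this]

/-- The initial state of the Schützenberger automaton. -/
def schutzenbergerInit (R : Set (InvWord X × InvWord X)) (w : InvWord X) :
    (schutzenberger R w).State :=
  ⟨((w * wordInv w : InvWord X) : InvPres R), greenR_mul_wordInv R w⟩

/-- The terminal state of the Schützenberger automaton. -/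
def schutzenbergerFinal (R : Set (InvWord X × InvWord X)) (w : InvWord X) :
    (schutzenberger R w).State :=
  ⟨(w : InvPres R), ⟨1, (mul_one _).symm⟩, 1, (mul_one _).symm⟩

theorem schutzenberger_init : (schutzenberger R w).init = {schutzenbergerInit R w} := rfl

theorem schutzenberger_final : (schutzenberger R w).final = {schutzenbergerFinal R w} := rfl

theorem schutzenbergerInit_mul (m : (schutzenberger R w).State) :
    (schutzenbergerInit R w).1 * m.1 = m.1 := by
  change (w : InvPres R) * (w : InvPres R)⁻¹ * m.1 = m.1
  rw [← schutzenberger_state_mul_inv m, mul_inv_mul]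

theorem reads_schutzenbergerInit {v : InvWord X} {q : (schutzenberger R w).State}
    (h : q.1 = (v : InvPres R)) :
    (schutzenberger R w).Reads v.toList (schutzenbergerInit R w) q := by
  rw [reads_schutzenberger_iff, ← h, schutzenbergerInit_mul]

/-- An accessible saturated inverse automaton which accepts `w` and maps to the Schützenberger
automaton of `w` is isomorphic to it. -/
theorem isomorphic_schutzenberger {C : Automaton (X × Bool)} (hd : C.Deterministic)
    (hi : C.Involutive) (hs : C.Saturated R) (ha : C.Accessible) {x₀ x₁ : C.State}
    (h₀ : C.init = {x₀}) (h₁ : C.final = {x₁}) (hw : C.Reads w.toList x₀ x₁)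
    {F : C.State → (schutzenberger R w).State} (hF : IsHom F)
    (hF₀ : F x₀ = schutzenbergerInit R w) : C.Isomorphic (schutzenberger R w) := by
  have hcon := presCon_le_pathCon hd hi hs
  -- The morphism back sends `m` to the state reached from `x₀` by any word `v` representing it.
  -- Such a `v` is readable from `x₀` because `v v⁻¹` and `w w⁻¹` are equal in the monoid and `w` is
  -- readable.
  have hex : ∀ m : (schutzenberger R w).State, ∃ x, ∀ v : InvWord X, m.1 = (v : InvPres R) →
      C.Reads v.toList x₀ x := by
    intro m
    obtain ⟨v, hv⟩ := Con.mk'_surjective (c := presCon R) m.1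
    have hv' : C.Reads (v * wordInv v).toList x₀ x₀ := by
      refine (hcon ?_ x₀ x₀).1 ((reads_mul_wordInv hd hi).2 ⟨rfl, x₁, hw⟩)
      refine (presCon R).eq.1 ?_
      have := schutzenberger_state_mul_inv m
      rw [← hv] at this
      exact this.symm
    obtain ⟨-, x, hx⟩ := (reads_mul_wordInv hd hi).1 hv'
    refine ⟨x, fun v' hv' => (hcon ?_ _ _).1 hx⟩
    exact (presCon R).eq.1 (hv.trans hv')
  choose G hG using hex
  have hGhom : IsHom G := by
    intro p x q h
    obtain ⟨v, hv⟩ := Con.mk'_surjective (c := presCon R) p.1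
    have hq : q.1 = ((v * FreeMonoid.of x : InvWord X) : InvPres R) := by
      rw [Con.coe_mul]
      exact (show q.1 = p.1 * _ from h).trans (congrArg (· * _) hv.symm)
    obtain ⟨r, hr, hr'⟩ := reads_mul.1 (hG q _ hq)
    rw [hd.reads (hG p v hv.symm) hr]
    exact reads_of.1 hr'
  have hG₀ : G (schutzenbergerInit R w) = x₀ :=
    hd.reads (hG _ _ rfl) ((reads_mul_wordInv hd hi).2 ⟨rfl, x₁, hw⟩)
  have hG₁ : G (schutzenbergerFinal R w) = x₁ := hd.reads (hG _ w rfl) hw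
  have hFG : ∀ m, F (G m) = m := by
    intro m
    obtain ⟨v, hv⟩ := Con.mk'_surjective (c := presCon R) m.1
    have h := hF.reads (hG m v hv.symm)
    rw [hF₀] at h
    exact deterministic_schutzenberger.reads h (reads_schutzenbergerInit hv.symm)
  have hGF : ∀ x, G (F x) = x := by
    intro x
    obtain ⟨p, hp, v, hv⟩ := ha x
    obtain rfl : p = x₀ := by simpa [h₀] using hp
    have h := hGhom.reads (hF.reads hv)
    rw [hF₀, hG₀] at h
    exact hd.reads h hv
  refine ⟨⟨F, G, hGF, hFG⟩, ?_, ?_, fun p a q => ⟨fun h => hF h, fun h => ?_⟩⟩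
  · simp [h₀, schutzenberger_init, hF₀]
  · simp [h₁, schutzenberger_final, ← hG₁, hFG]
  · have := hGhom h
    simpa [hGF] using this

end

/-! ### Products, added loops and contractions -/

theorem reads_prod_iff {S : Type u} {ι : Type u} {B : ι → Automaton S} {w : List S}
    {p q : (prod B).State} : (prod B).Reads w p q ↔ ∀ i, (B i).Reads w (p i) (q i) := by
  induction w generalizing p with
  | nil => exact funext_iff
  | cons a w ih =>
    constructor
    · rintro ⟨r, h, h'⟩ i
      exact ⟨r i, h i, ih.1 h' i⟩
    · intro h
      choose r h h' using h
      exact ⟨r, h, ih.2 h'⟩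

/-- Every state on a path between two trim states lies itself on a successful path. -/
theorem reads_trim_of_reads {S : Type u} {B : Automaton S} {w : List S} {p q : B.trim.State}
    (h : B.Reads w p.1 q.1) : B.trim.Reads w p q := by
  induction w generalizing p with
  | nil => exact Subtype.ext h
  | cons a w ih =>
    obtain ⟨r, h₁, h₂⟩ := h
    obtain ⟨p₀, hp₀, _, _, v, _, hv, _⟩ := p.2
    obtain ⟨_, _, t, ht, _, v', _, hv'⟩ := q.2
    refine ⟨⟨r, p₀, hp₀, t, ht, v ++ [a], w ++ v', reads_append.2 ⟨_, hv, reads_singleton.2 h₁⟩,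
      reads_append.2 ⟨_, h₂, hv'⟩⟩, h₁, ih h₂⟩

theorem isHom_trim {S : Type u} (B : Automaton S) : IsHom (B := B.trim) (C := B) Subtype.val :=
  fun _ _ _ h => h

theorem exists_reads_final_trim {S : Type u} {B : Automaton S} (p : B.trim.State) :
    ∃ t ∈ B.trim.final, ∃ w, B.trim.Reads w p t := by
  obtain ⟨p₀, hp₀, t, ht, v, w, hv, hw⟩ := p.2
  exact ⟨⟨t, p₀, hp₀, t, ht, v ++ w, [], reads_append.2 ⟨_, hv, hw⟩, rfl⟩, ht, w,
    reads_trim_of_reads hw⟩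

theorem accessible_trim {S : Type u} {B : Automaton S} : B.trim.Accessible := by
  intro p
  obtain ⟨p₀, hp₀, t, ht, v, w, hv, hw⟩ := p.2
  exact ⟨⟨p₀, p₀, hp₀, t, ht, [], v ++ w, rfl, reads_append.2 ⟨_, hv, hw⟩⟩, hp₀, v,
    reads_trim_of_reads hv⟩

section
variable {A : Type u} {i : A}

theorem involutive_addLoops {B : Automaton ({a : A // a ≠ i} × Bool)} (hB : B.Involutive) :
    (B.addLoops i).Involutive := by
  rintro p x q (⟨hx, h⟩ | ⟨hx, h⟩)
  · exact .inl ⟨hx, h.symm⟩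
  · exact .inr ⟨hx, hB h⟩

theorem involutive_eraseEdges {B : Automaton (A × Bool)} (hB : B.Involutive) :
    (B.eraseEdges i).Involutive :=
  fun _ _ _ h => hB h

theorem involutive_contracted {B : Automaton (A × Bool)} (hB : B.Involutive) :
    (B.contracted i).Involutive :=
  ((involutive_eraseEdges hB).identify _).identify _

/-- The canonical map to the contracted automaton. -/
def toContracted (i : A) (B : Automaton (A × Bool)) (p : B.State) : (B.contracted i).State :=
  Quot.mk _ (Quot.mk _ p)

theorem contracted_init {B : Automaton (A × Bool)} :
    (B.contracted i).init = toContracted i B '' B.init :=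
  Set.image_image _ _ _

theorem contracted_final {B : Automaton (A × Bool)} :
    (B.contracted i).final = toContracted i B '' B.final :=
  Set.image_image _ _ _

variable [DecidableEq A]

theorem eraseWord_of_eq (x : A × Bool) (hx : x.1 = i) :
    eraseWord i (FreeMonoid.of x) = 1 := by
  simp [eraseWord, hx]

theorem eraseWord_of_ne (x : A × Bool) (hx : x.1 ≠ i) :
    eraseWord i (FreeMonoid.of x) = FreeMonoid.of (⟨x.1, hx⟩, x.2) := by
  simp [eraseWord, hx]

theorem edge_addLoops_iff {B : Automaton ({a : A // a ≠ i} × Bool)} {x : A × Bool}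
    {p q : B.State} : (B.addLoops i).edge p x q ↔
      B.Reads (eraseWord i (FreeMonoid.of x)).toList p q := by
  change _ ∨ _ ↔ _
  by_cases hx : x.1 = i
  · rw [eraseWord_of_eq x hx, reads_one]
    simp [hx]
  · rw [eraseWord_of_ne x hx, reads_of]
    simp [hx]

theorem reads_addLoops_iff {B : Automaton ({a : A // a ≠ i} × Bool)} {w : InvWord A}
    {p q : B.State} : (B.addLoops i).Reads w.toList p q ↔ B.Reads (eraseWord i w).toList p q := by
  induction w using FreeMonoid.recOn generalizing p with
  | one => rfl
  | of_mul x w ih =>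
    rw [map_mul (eraseWord i), reads_mul (B := B)]
    refine reads_mul.trans ?_
    exact exists_congr fun r => and_congr (reads_of.trans edge_addLoops_iff) ih

theorem reads_toContracted {B : Automaton (A × Bool)} (hB : B.Involutive) {w : InvWord A}
    {p q : B.State} (h : B.Reads w.toList p q) :
    (B.contracted i).Reads (eraseWord i w).toList (toContracted i B p) (toContracted i B q) := by
  induction w using FreeMonoid.recOn generalizing p with
  | one => exact congrArg _ h
  | of_mul x w ih =>
    obtain ⟨r, h₁, h₂⟩ := reads_mul.1 h
    rw [reads_of] at h₁
    rw [map_mul]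
    refine reads_mul.2 ⟨_, ?_, ih h₂⟩
    by_cases hx : x.1 = i
    · rw [eraseWord_of_eq x hx, reads_one]
      refine congrArg (Quot.mk _) ?_
      obtain ⟨a, b⟩ := x
      obtain rfl : a = i := hx
      -- Only edges labelled `i` are contracted by definition; an edge labelled `i⁻¹` is treated
      -- through its inverse edge.
      cases b
      · exact (Quot.sound (hB h₁)).symm
      · exact Quot.sound h₁
    · rw [eraseWord_of_ne x hx, reads_of]
      exact isHom_identify _ _ (isHom_identify _ _ h₁)

theorem accessible_contracted {B : Automaton (A × Bool)} (hB : B.Involutive)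
    (ha : B.Accessible) : (B.contracted i).Accessible := by
  rintro ⟨⟨q⟩⟩
  obtain ⟨p, hp, w, hw⟩ := ha q
  exact ⟨toContracted i B p, contracted_init ▸ ⟨p, hp, rfl⟩, _,
    reads_toContracted hB (w := FreeMonoid.ofList w) hw⟩

/-- The universal property of contraction: a morphism into `C` with loops added must collapse the
`i`-edges, and determinism of `C` takes care of the folding. -/
theorem exists_isHom_contracted {B : Automaton (A × Bool)}
    {C : Automaton ({a : A // a ≠ i} × Bool)} (hC : C.Deterministic) {f : B.State → C.State}
    (hf : IsHom (C := C.addLoops i) f) :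
    ∃ g : (B.contracted i).State → C.State, IsHom g ∧ ∀ p, g (toContracted i B p) = f p := by
  have h₁ : IsHom (B := B.eraseEdges i) (C := C) f := by
    intro p x q h
    have := edge_addLoops_iff.1 (hf h)
    rwa [eraseWord_of_ne (x.1.1, x.2) x.1.2, reads_of] at this
  have h₂ : ∀ p q, B.edge p (i, true) q → f p = f q := by
    intro p q h
    have := edge_addLoops_iff.1 (hf h)
    rwa [eraseWord_of_eq (i, true) rfl, reads_one] at this
  have h₃ := isHom_identify_lift h₁ h₂
  exact ⟨Quot.lift (Quot.lift f h₂) fun p q h => h.map_eq hC h₃, isHom_identify_lift h₃ _,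
    fun p => rfl⟩

/-! ### Loops of an automaton after erasing a letter -/

/-- The closed inverse submonoid generated by the labels of the loops at `p`, after erasing all
occurrences of `i`. -/
def loopSubmonoid (i : A) (R : Set (InvWord {a : A // a ≠ i} × InvWord {a : A // a ≠ i}))
    {B : Automaton (A × Bool)} (hB : B.Involutive) (p : B.State) :
    ClosedInverseSubmonoid (InvPres R) where
  carrier := {m | ∃ v : InvWord A, B.Reads v.toList p p ∧
    NatLE ((eraseWord i v : InvWord {a : A // a ≠ i}) : InvPres R) m}
  one_mem' := ⟨1, rfl, NatLE.refl _⟩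
  mul_mem' := by
    rintro a b ⟨v, hv, hv'⟩ ⟨w, hw, hw'⟩
    refine ⟨v * w, reads_mul.2 ⟨p, hv, hw⟩, ?_⟩
    rw [map_mul, Con.coe_mul]
    exact hv'.mul hw'
  inv_mem := by
    rintro a ⟨v, hv, hv'⟩
    refine ⟨wordInv v, hB.reads hv, ?_⟩
    rw [eraseWord_wordInv]
    exact hv'.inv
  up := by
    rintro a b ⟨v, hv, hv'⟩ h
    exact ⟨v, hv, hv'.trans h⟩

theorem mul_inv_mem_loopSubmonoid
    {R : Set (InvWord {a : A // a ≠ i} × InvWord {a : A // a ≠ i})}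
    {B : Automaton (A × Bool)} (hB : B.Involutive) {p q : B.State} {v w : InvWord A}
    (hv : B.Reads v.toList p q) (hw : B.Reads w.toList p q) :
    ((eraseWord i v : InvWord {a : A // a ≠ i}) : InvPres R) *
      ((eraseWord i w : InvWord {a : A // a ≠ i}) : InvPres R)⁻¹ ∈
        (loopSubmonoid i R hB p).toSubmonoid := by
  refine ⟨v * wordInv w, reads_mul.2 ⟨q, hv, hB.reads hw⟩, ?_⟩
  rw [map_mul, eraseWord_wordInv]
  exact NatLE.refl _

/-- If the closure of a contracted automaton has a loop with label `w` at the image of `p`, then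
some loop at `p` is labelled, after erasing, by a word that lies below `w`. -/
theorem exists_loop_of_closure_loop
    {R : Set (InvWord {a : A // a ≠ i} × InvWord {a : A // a ≠ i})}
    {B : Automaton (A × Bool)} (hB : B.Involutive) {p : B.State}
    (hp : ∀ q, ∃ w, B.Reads w p q) {w : InvWord {a : A // a ≠ i}}
    (hw : (closure R (B.contracted i)).Reads w.toList (toClosure R _ (toContracted i B p))
      (toClosure R _ (toContracted i B p))) :
    ∃ v : InvWord A, B.Reads v.toList p p ∧
      NatLE ((eraseWord i v : InvWord {a : A // a ≠ i}) : InvPres R) (w : InvPres R) := by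
  set H := loopSubmonoid i R hB p
  have hp' : ∀ q, ∃ w : InvWord A, B.Reads w.toList p q := hp
  choose v hv using hp'
  -- Two paths from `p` to `q` differ by a loop at `p`, so their erased labels define the same coset
  -- of `H`. The coset is thus independent of the choice of `v q`, which makes `f` a morphism.
  let f : B.State → H.cosetAutomaton.State := fun q =>
    H.coset ((eraseWord i (v q) : InvWord {a : A // a ≠ i}) : InvPres R)
      (mul_inv_mem_loopSubmonoid hB (hv q) (hv q))
  have hf : IsHom (C := H.cosetAutomaton.addLoops i) f := by
    intro q x r h
    refine edge_addLoops_iff.2 ?_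
    have hr : B.Reads (v q * FreeMonoid.of x).toList p r :=
      reads_mul.2 ⟨q, hv q, reads_of.2 h⟩
    refine ClosedInverseSubmonoid.reads_coset_iff.2 ⟨?_, ClosedInverseSubmonoid.coset_eq_iff.2 ?_⟩
    · rw [← Con.coe_mul, ← map_mul]
      exact mul_inv_mem_loopSubmonoid hB hr hr
    · rw [← Con.coe_mul, ← map_mul]
      exact mul_inv_mem_loopSubmonoid hB hr (hv r)
  obtain ⟨g, hg, hg'⟩ :=
    exists_isHom_contracted ClosedInverseSubmonoid.deterministic_cosetAutomaton hf
  obtain ⟨F, hF, hF'⟩ := exists_isHom_closure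
    ClosedInverseSubmonoid.deterministic_cosetAutomaton
    ClosedInverseSubmonoid.involutive_cosetAutomaton
    ClosedInverseSubmonoid.saturated_cosetAutomaton hg
  have h1 : (1 : InvPres R) * 1⁻¹ ∈ H.toSubmonoid := by
    rw [IsInverseMonoid.inv_one, mul_one]
    exact H.one_mem
  have hfp : f p = H.coset 1 h1 := by
    refine ClosedInverseSubmonoid.coset_eq_iff.2 ?_
    exact mul_inv_mem_loopSubmonoid (w := 1) hB (hv p) rfl
  have h := hF.reads hw
  rw [hF', hg', hfp] at h
  exact ClosedInverseSubmonoid.mem_of_reads_coset_one h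

end

end Automaton

/-! ### The product automaton and the image of the eraser morphism -/

section
variable {A : Type u} [DecidableEq A] {R : Set (InvWord A × InvWord A)}
  {w : ∀ i : A, InvWord {a : A // a ≠ i}}

open Automaton

theorem involutive_productAutomaton : (productAutomaton R w).Involutive :=
  fun _ _ _ h i => involutive_addLoops involutive_schutzenberger (h i)

theorem mem_productAutomaton_init {p : (productAutomaton R w).State} :
    p ∈ (productAutomaton R w).init ↔
      p.1 = fun i => schutzenbergerInit (eraseRel i R) (w i) :=
  funext_iff.symm

theorem mem_productAutomaton_final {p : (productAutomaton R w).State} :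
    p ∈ (productAutomaton R w).final ↔
      p.1 = fun i => schutzenbergerFinal (eraseRel i R) (w i) :=
  funext_iff.symm

theorem productAutomaton_init_eq {p : (productAutomaton R w).State}
    (hp : p ∈ (productAutomaton R w).init) : (productAutomaton R w).init = {p} :=
  Set.eq_singleton_iff_unique_mem.2 ⟨hp, fun _ hq => Subtype.ext
    ((mem_productAutomaton_init.1 hq).trans (mem_productAutomaton_init.1 hp).symm)⟩

theorem productAutomaton_final_eq {p : (productAutomaton R w).State}
    (hp : p ∈ (productAutomaton R w).final) : (productAutomaton R w).final = {p} :=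
  Set.eq_singleton_iff_unique_mem.2 ⟨hp, fun _ hq => Subtype.ext
    ((mem_productAutomaton_final.1 hq).trans (mem_productAutomaton_final.1 hp).symm)⟩

theorem reads_productAutomaton {v : InvWord A} {p q : (productAutomaton R w).State}
    (h : (productAutomaton R w).Reads v.toList p q) (i : A) :
    (q.1 i).1 = (p.1 i).1 * ((eraseWord i v : InvWord {a : A // a ≠ i}) :
      InvPres (eraseRel i R)) :=
  reads_schutzenberger_iff.1 (reads_addLoops_iff.1 (reads_prod_iff.1 ((isHom_trim _).reads h) i))

theorem mem_mrange_eraserMorphism_iff :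
    (fun i : A => ((w i : InvWord {a : A // a ≠ i}) : InvPres (eraseRel i R))) ∈
        MonoidHom.mrange (eraserMorphism R) ↔
      ∃ u : InvWord A, ∀ i, ((eraseWord i u : InvWord {a : A // a ≠ i}) :
        InvPres (eraseRel i R)) = w i := by
  constructor
  · rintro ⟨m, hm⟩
    obtain ⟨u, rfl⟩ := Con.mk'_surjective (c := presCon R) m
    exact ⟨u, fun i => congrFun hm i⟩
  · rintro ⟨u, hu⟩
    exact ⟨(u : InvPres R), funext hu⟩

theorem exists_accepting_path {u : InvWord A}
    (hu : ∀ i, ((eraseWord i u : InvWord {a : A // a ≠ i}) : InvPres (eraseRel i R)) = w i) :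
    ∃ p ∈ (productAutomaton R w).init, ∃ q ∈ (productAutomaton R w).final,
      (productAutomaton R w).Reads u.toList p q := by
  let p : ∀ i : A, (schutzenberger (eraseRel i R) (w i)).State :=
    fun i => schutzenbergerInit _ _
  let q : ∀ i : A, (schutzenberger (eraseRel i R) (w i)).State :=
    fun i => schutzenbergerFinal _ _
  have h : (prod fun i : A => (schutzenberger (eraseRel i R) (w i)).addLoops i).Reads
      u.toList p q :=
    reads_prod_iff.2 fun i => reads_addLoops_iff.2 (reads_schutzenbergerInit (hu i).symm)
  refine ⟨⟨p, p, fun i => rfl, q, fun i => rfl, [], _, rfl, h⟩, fun i => rfl,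
    ⟨q, p, fun i => rfl, q, fun i => rfl, _, [], h, rfl⟩, fun i => rfl, ?_⟩
  exact reads_trim_of_reads h

theorem isomorphic_closure_contracted {u : InvWord A}
    (hu : ∀ i, ((eraseWord i u : InvWord {a : A // a ≠ i}) : InvPres (eraseRel i R)) = w i)
    (i : A) : Isomorphic (closure (eraseRel i R) (contracted i (productAutomaton R w)))
      (schutzenberger (eraseRel i R) (w i)) := by
  obtain ⟨p, hp, q, hq, h⟩ := exists_accepting_path hu
  have hi : (contracted i (productAutomaton R w)).Involutive :=
    involutive_contracted involutive_productAutomaton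
  have hf : IsHom (B := productAutomaton R w)
      (C := (schutzenberger (eraseRel i R) (w i)).addLoops i) fun p => p.1 i :=
    fun _ _ _ h => h i
  obtain ⟨g, hg, hg'⟩ := exists_isHom_contracted deterministic_schutzenberger hf
  obtain ⟨F, hF, hF'⟩ := exists_isHom_closure deterministic_schutzenberger
    involutive_schutzenberger saturated_schutzenberger hg
  refine isomorphic_schutzenberger (x₀ := toClosure _ _ (toContracted i _ p))
    (x₁ := toClosure _ _ (toContracted i _ q)) deterministic_closure (involutive_closure hi)
    saturated_closure
    (accessible_closure (accessible_contracted involutive_productAutomaton accessible_trim))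
    ?_ ?_ ?_ hF ?_
  · rw [closure_init, contracted_init, productAutomaton_init_eq hp, Set.image_singleton,
      Set.image_singleton]
  · rw [closure_final, contracted_final, productAutomaton_final_eq hq, Set.image_singleton,
      Set.image_singleton]
  · refine (presCon_le_pathCon deterministic_closure (involutive_closure hi) saturated_closure
      ((presCon _).eq.1 (hu i)) _ _).1 ?_
    exact isHom_toClosure.reads (reads_toContracted involutive_productAutomaton h)
  · rw [hF', hg', mem_productAutomaton_init.1 hp]

/-- The word `w i (w i)⁻¹` labels a loop at the initial state of the Schützenberger automaton. The
inverse isomorphism carries it to the closure, and `exists_loop_of_closure_loop` brings it down to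
the product. -/
theorem exists_loop_of_isomorphic {i : A}
    (h : Isomorphic (closure (eraseRel i R) (contracted i (productAutomaton R w)))
      (schutzenberger (eraseRel i R) (w i))) :
    ∃ p ∈ (productAutomaton R w).init, ∃ v : InvWord A,
      (productAutomaton R w).Reads v.toList p p ∧
      NatLE ((eraseWord i v : InvWord {a : A // a ≠ i}) : InvPres (eraseRel i R))
        ((w i * wordInv (w i) : InvWord {a : A // a ≠ i}) : InvPres (eraseRel i R)) := by
  obtain ⟨f, hf₀, -, hf⟩ := h
  obtain ⟨x, hx, hfx⟩ : schutzenbergerInit (eraseRel i R) (w i) ∈ f '' _ := hf₀.symm.subset rfl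
  obtain ⟨p', hp', rfl⟩ := closure_init.subset hx
  obtain ⟨p, hp, rfl⟩ := contracted_init.subset hp'
  have hsymm : IsHom (B := schutzenberger (eraseRel i R) (w i))
      (C := closure (eraseRel i R) (contracted i (productAutomaton R w))) f.symm := by
    intro p a q h
    rw [hf, f.apply_symm_apply, f.apply_symm_apply]
    exact h
  have hr := hsymm.reads (reads_schutzenbergerInit (R := eraseRel i R) (w := w i)
    (v := w i * wordInv (w i)) (q := schutzenbergerInit _ _) rfl)
  rw [← hfx, f.symm_apply_apply] at hr
  have hreach : ∀ q, ∃ v, (productAutomaton R w).Reads v p q := by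
    intro q
    obtain ⟨p', hp', v, hv⟩ := accessible_trim q
    obtain rfl : p' = p := (productAutomaton_init_eq hp).subset hp'
    exact ⟨v, hv⟩
  exact ⟨p, hp, exists_loop_of_closure_loop involutive_productAutomaton hreach hr⟩

theorem exists_common_loop [Finite A] {p : (productAutomaton R w).State}
    (e : ∀ i : A, InvPres (eraseRel i R))
    (h : ∀ i, ∃ v : InvWord A, (productAutomaton R w).Reads v.toList p p ∧
      NatLE ((eraseWord i v : InvWord {a : A // a ≠ i}) : InvPres (eraseRel i R))
        (e i * (e i)⁻¹)) :
    ∃ v : InvWord A, (productAutomaton R w).Reads v.toList p p ∧ ∀ i,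
      e i * (e i)⁻¹ * ((eraseWord i v : InvWord {a : A // a ≠ i}) : InvPres (eraseRel i R)) =
        ((eraseWord i v : InvWord {a : A // a ≠ i}) : InvPres (eraseRel i R)) := by
  have key : ∀ s : Set A, s.Finite → ∃ v : InvWord A,
      (productAutomaton R w).Reads v.toList p p ∧ ∀ i ∈ s,
      e i * (e i)⁻¹ * ((eraseWord i v : InvWord {a : A // a ≠ i}) : InvPres (eraseRel i R)) =
        ((eraseWord i v : InvWord {a : A // a ≠ i}) : InvPres (eraseRel i R)) := by
    intro s hs
    induction s, hs using Set.Finite.induction_on with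
    | empty => exact ⟨1, rfl, by simp⟩
    | @insert j s _ _ ih =>
      obtain ⟨v, hv, hvs⟩ := ih
      obtain ⟨z, hz, hzj⟩ := h j
      -- Using `z z⁻¹` in place of `z` contributes an idempotent: it commutes with each `e i (e
      -- i)⁻¹`, so the letters already treated keep their property.
      refine ⟨z * wordInv z * v, reads_mul.2 ⟨p, reads_mul.2 ⟨p, hz,
        involutive_productAutomaton.reads hz⟩, hv⟩, ?_⟩
      intro i hi
      rw [map_mul, map_mul, eraseWord_wordInv, Con.coe_mul, Con.coe_mul, ← InvPres.coe_inv]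
      rcases hi with rfl | hi
      · rw [← mul_assoc, ← mul_assoc, hzj.mul_inv_mul_of_mul_inv]
      · rw [← mul_assoc, IsInverseMonoid.comm, mul_assoc, hvs i hi]
  obtain ⟨v, hv, hvs⟩ := key Set.univ Set.finite_univ
  exact ⟨v, hv, fun i => hvs i trivial⟩

theorem exists_eraseWord_eq_of_isomorphic [Finite A]
    (h : ∀ i : A, Isomorphic (closure (eraseRel i R) (contracted i (productAutomaton R w)))
      (schutzenberger (eraseRel i R) (w i))) :
    ∃ u : InvWord A, ∀ i, ((eraseWord i u : InvWord {a : A // a ≠ i}) :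
        InvPres (eraseRel i R)) = w i := by
  -- Some letter is needed to obtain the initial state of the product from an isomorphism; without
  -- letters the tuple is empty.
  rcases isEmpty_or_nonempty A with hA | ⟨⟨j⟩⟩
  · exact ⟨1, isEmptyElim⟩
  obtain ⟨p, hp, -⟩ := exists_loop_of_isomorphic (h j)
  have hloop : ∀ i, ∃ v : InvWord A, (productAutomaton R w).Reads v.toList p p ∧
      NatLE ((eraseWord i v : InvWord {a : A // a ≠ i}) : InvPres (eraseRel i R))
        ((w i : InvPres (eraseRel i R)) * (w i : InvPres (eraseRel i R))⁻¹) := by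
    intro i
    obtain ⟨p', hp', hv⟩ := exists_loop_of_isomorphic (h i)
    obtain rfl : p' = p := (productAutomaton_init_eq hp).subset hp'
    exact hv
  obtain ⟨v, hv, hvs⟩ := exists_common_loop _ hloop
  obtain ⟨q, hq, z, hz⟩ : ∃ q ∈ (productAutomaton R w).final, ∃ z : InvWord A,
      (productAutomaton R w).Reads z.toList p q := exists_reads_final_trim p
  -- In coordinate `i` the path `v z` leads from `w i (w i)⁻¹` to `w i`, and the factor `w i (w
  -- i)⁻¹` is absorbed by the erased `v`.
  refine ⟨v * z, fun i => ?_⟩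
  have hr := reads_productAutomaton (reads_mul.2 ⟨p, hv, hz⟩) i
  rw [mem_productAutomaton_init.1 hp, mem_productAutomaton_final.1 hq] at hr
  refine Eq.trans ?_ hr.symm
  rw [map_mul, Con.coe_mul]
  exact (congrArg (· * _) (hvs i).symm).trans (mul_assoc _ _ _)

end

theorem proposition4p13 {A : Type u} [Finite A] [DecidableEq A]
    (R : Set (InvWord A × InvWord A)) (w : ∀ i : A, InvWord {a : A // a ≠ i}) :
    (fun i : A => ((w i : InvWord {a : A // a ≠ i}) : InvPres (eraseRel i R))) ∈
        MonoidHom.mrange (eraserMorphism R) ↔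
      ∀ i : A, Automaton.Isomorphic
        (Automaton.closure (eraseRel i R) (Automaton.contracted i (productAutomaton R w)))
        (schutzenberger (eraseRel i R) (w i)) := by
  rw [mem_mrange_eraserMorphism_iff]
  exact ⟨fun ⟨_, hu⟩ => isomorphic_closure_contracted hu, exists_eraseWord_eq_of_isomorphic⟩
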